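/- Let $A\in\mathbb R^{m\times n}$ be a coding matrix with orthonormal columns ($A^*A=I$). A signal $x\in\mathbb R^n$ is received as $y=Ax+e+z$, where $e\in\mathbb R^m$ is a vector of gross errors with at most $k$ nonzero entries, and the small errors $z_1,\dots,z_m$ are i.i.d. $N(0,\sigma^2)$. Let $(P_2)$ be the program $$\min_{\tilde x\in\mathbb R^n,\ \tilde z\in\mathbb R^m}\ \|y-A\tilde x-\tilde z\|_{\ell_1}\quad\text{subject to}\quad \|\tilde z\|_{\ell_2}\le\varepsilon,\quad A^*\tilde z=0 .$$ For a matrix $\Phi$ let $\delta_k(\Phi)$ be the smallest number $\delta\ge 0$ such that $(1-\delta)\|v\|_{\ell_2}^2\le\|\Phi v\|_{\ell_2}^2\le(1+\delta)\|v\|_{\ell_2}^2$ for all vectors $v$ with at most $k$ nonzero entries, and write $\delta_k=\delta_k\big(\sqrt{m/n}\,A^*\big)$. For every $t>0$ there is a constant $C_2'>0$, depending only on $t$, such that the following holds with $$\varepsilon=\sqrt{(m-n)(1+t)}\cdot\sigma,\qquad \gamma=\frac{\sqrt{1+2t}-1}{\sqrt2}.$$ (i) If $\delta_{3k}+\tfrac12\delta_{2k}<\tfrac12\left(\tfrac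 mn-1\right)$, then for every $\sigma\ge0$, with probability exceeding $1-e^{-\gamma^2(m-n)/2}-e^{-m/2}$ over $z$, for all signals $x$ and all gross errors $e$ with at most $k$ nonzero entries, $(P_2)$ has a solution and every solution $(\hat x,\hat z)$ of $(P_2)$ obeys $$\|\hat x-x\|_{\ell_2}^2\le C_2'\cdot m\cdot\sigma^2 .$$ (ii) In particular, suppose that $0<n<m$ and that the orthonormal columns of $A$ are selected uniformly at random. There are a positive function $\rho^*$ on $(0,1)$ and constants $\kappa,K>0$, none of which depends on $t,m,n,k$ or $\sigma$, such that if $k\le\rho^*(n/m)\cdot m$, then with probability at least $1-Ke^{-\kappa(m-n)}$ the matrix $A$ is such that the conclusion of (i) holds, with the same $C_2'$. -/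

import Mathlib

open MeasureTheory ProbabilityTheory Matrix

noncomputable section

/-- The `ℓ₁` norm of a vector. -/
def l1Norm {ι : Type*} [Fintype ι] (v : ι → ℝ) : ℝ := ‖WithLp.toLp 1 v‖

/-- The `ℓ₂` (Euclidean) norm of a vector. -/
def l2Norm {ι : Type*} [Fintype ι] (v : ι → ℝ) : ℝ := ‖WithLp.toLp 2 v‖

/-- A vector is `k`-sparse if it has at most `k` nonzero entries. -/
def IsSparse {ι : Type*} (k : ℕ) (v : ι → ℝ) : Prop := {i | v i ≠ 0}.ncard ≤ k

/-- The `k`-th isometry constant `δ_k` of a matrix `Φ`: the smallest number `δ` such that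
`(1 - δ) ‖x‖² ≤ ‖Φ x‖² ≤ (1 + δ) ‖x‖²` for all `k`-sparse `x`. As soon as a nonzero `k`-sparse
vector exists, the two inequalities force `0 ≤ δ`; the clause `0 ≤ δ` only serves
to give `δ_0` the value `0`. -/
def isometryConstant {ι κ : Type*} [Fintype ι] [Fintype κ] (Φ : Matrix ι κ ℝ) (k : ℕ) : ℝ :=
  sInf {δ : ℝ | 0 ≤ δ ∧ ∀ x : κ → ℝ, IsSparse k x →
    (1 - δ) * l2Norm x ^ 2 ≤ l2Norm (Φ *ᵥ x) ^ 2 ∧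
    l2Norm (Φ *ᵥ x) ^ 2 ≤ (1 + δ) * l2Norm x ^ 2}

/-- The constraints of the second-order cone program `(P₂)`, on the variable `z'`
(the variable `x'` is unconstrained). -/
def SOCPFeasible {m n : ℕ} (A : Matrix (Fin m) (Fin n) ℝ) (ε : ℝ) (z' : Fin m → ℝ) : Prop :=
  l2Norm z' ≤ ε ∧ Aᵀ *ᵥ z' = 0

/-- `(xhat, zhat)` is a solution of the program `(P₂)`: minimize `‖y - A x' - z'‖₁` subject to
`‖z'‖₂ ≤ ε` and `Aᵀ z' = 0`. -/
def IsSOCPSolution {m n : ℕ} (A : Matrix (Fin m) (Fin n) ℝ) (y : Fin m → ℝ) (ε : ℝ)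
    (xhat : Fin n → ℝ) (zhat : Fin m → ℝ) : Prop :=
  SOCPFeasible A ε zhat ∧
  ∀ (x' : Fin n → ℝ) (z' : Fin m → ℝ), SOCPFeasible A ε z' →
    l1Norm (y - A *ᵥ xhat - zhat) ≤ l1Norm (y - A *ᵥ x' - z')

/-- The law of a vector of `m` i.i.d. `N(0, σ²)` random variables. -/
def noiseLaw (m : ℕ) (σ : ℝ) : Measure (Fin m → ℝ) :=
  Measure.pi fun _ => gaussianReal 0 (σ ^ 2).toNNReal

/-- The exponent parameter `γ = (√(1 + 2t) - 1) / √2`. -/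
def gammaOf (t : ℝ) : ℝ := (√(1 + 2 * t) - 1) / √2

/-- With `ε = √((m - n)(1 + t)) σ` and i.i.d. `N(0, σ²)` small errors `z`, with probability
exceeding `1 - e^{-γ²(m-n)/2} - e^{-m/2}` the following holds for all signals `x` and
all `k`-sparse gross errors `e`: the program `(P₂)` with data `y = A x + (e + z)` has a solution,
and every solution `(xhat, zhat)` obeys `‖xhat - x‖² ≤ C m σ²`. -/
def SOCPDecodes {m n : ℕ} (A : Matrix (Fin m) (Fin n) ℝ) (k : ℕ) (t C : ℝ) : Prop :=
  ∀ σ : ℝ, 0 ≤ σ →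
    ∃ E : Set (Fin m → ℝ), MeasurableSet E ∧
      1 - Real.exp (-(gammaOf t ^ 2 * ((m : ℝ) - n) / 2)) - Real.exp (-((m : ℝ) / 2))
        < (noiseLaw m σ).real E ∧
      ∀ z ∈ E, ∀ (x : Fin n → ℝ) (e : Fin m → ℝ), IsSparse k e →
        (∃ xhat zhat,
          IsSOCPSolution A (A *ᵥ x + (e + z)) (√(((m : ℝ) - n) * (1 + t)) * σ) xhat zhat) ∧
        ∀ xhat zhat,
          IsSOCPSolution A (A *ᵥ x + (e + z)) (√(((m : ℝ) - n) * (1 + t)) * σ) xhat zhat →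
          l2Norm (xhat - x) ^ 2 ≤ C * m * σ ^ 2

/-- `μ` is the law of an `m × n` matrix whose orthonormal columns are selected uniformly at random:
the (unique) probability measure that is carried by the matrices with orthonormal columns and
is invariant under all orthogonal transformations of `ℝ^m`. -/
structure IsUniformOrthonormal {m n : ℕ} (μ : Measure (Fin m → Fin n → ℝ)) : Prop where
  prob : IsProbabilityMeasure μ
  orthonormal : ∀ᵐ A ∂μ, (Matrix.of A)ᵀ * Matrix.of A = 1
  invariant : ∀ U ∈ Matrix.orthogonalGroup (Fin m) ℝ,
    μ.map (fun A => Matrix.of.symm (U * Matrix.of A)) = μ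

end

/-!
Let `Q = 1 - A Aᵀ` be the orthogonal projection onto the kernel of `Aᵀ` and `p = 1 - n / m`. The
whole argument runs through one property of `A`, `ResidualIsometry`: on sparse vectors `‖Q v‖²`
stays close to `p ‖v‖²`.

*Decoding.* The misfit `y - A xhat - zhat` of a solution competes with the gross errors `e`, so that
its `ℓ₁` norm is at most `‖e‖₁` as soon as `‖Q z‖ ≤ ε`. Hence their difference `h` has at least half
of its `ℓ₁` norm on the support of `e`, while `‖Q h‖ ≤ 2 ε`. If `Q / √p` is a restricted isometry
with constant `1/3` at sparsity `2 k`, cutting `h` into blocks of decreasing magnitude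
(`exists_head_block`) gives `p ‖h‖² ≤ 43 ‖Q h‖²` (`ResidualIsometry.norm_le_of_cone`), and
`xhat - x = Aᵀ (z - h)`. The hypothesis on `δ_{3k}` and `δ_{2k}` implies the constant `1/3`
because `δ_{2k} ≤ δ_{3k}`; this is why the final constant depends on `t` only, and not on how close
the hypothesis is to equality. By rotation invariance, `‖Q z‖²` and `‖z‖²` are chi-square variables
with `m - n` and `m` degrees of freedom, and the Chernoff bound `chiSquare_upper_tail` gives the
probability, with the exponent `γ`.

*Random matrices.* For a uniformly random `A` the law of `‖Q v‖ / ‖v‖` does not depend on `v`, so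
that `v` may be replaced by an independent Gaussian vector. For fixed `A`, chi-square concentration
then shows that `‖Q v‖²` is far from `p ‖v‖²` with probability at most `4 e^{-c (m - n)}`
(`IsUniformOrthonormal.measure_badMatrices_le`). A union bound over all integer vectors in a
ball of radius `√(32 k)`, and rounding of sparse vectors to multiples of these
(`ResidualIsometry.improve`), yields the restricted isometry. The number of these integer vectors
is at most `e^{c (m - n) / 2}` for `k ≤ ρ (n / m) m` (`card_net_le`).
-/

noncomputable section

/-! ### Euclidean norms of coordinate vectors -/

section Norms

variable {ι : Type*} [Fintype ι]

lemma l2Norm_nonneg (v : ι → ℝ) : 0 ≤ l2Norm v := norm_nonneg _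

lemma l2Norm_sq (v : ι → ℝ) : l2Norm v ^ 2 = v ⬝ᵥ v := by
  rw [l2Norm, EuclideanSpace.norm_sq_eq]
  simp [dotProduct, sq]

lemma l2Norm_zero : l2Norm (0 : ι → ℝ) = 0 := by simp [l2Norm]

lemma l2Norm_add_le (v w : ι → ℝ) : l2Norm (v + w) ≤ l2Norm v + l2Norm w := by
  simpa [l2Norm] using norm_add_le (WithLp.toLp 2 v) (WithLp.toLp 2 w)

lemma l2Norm_sub_le (v w : ι → ℝ) : l2Norm (v - w) ≤ l2Norm v + l2Norm w := by
  simpa [l2Norm] using norm_sub_le (WithLp.toLp 2 v) (WithLp.toLp 2 w)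

lemma l2Norm_smul (c : ℝ) (v : ι → ℝ) : l2Norm (c • v) = |c| * l2Norm v := by
  simp [l2Norm, norm_smul]

lemma dotProduct_self_nonneg (v : ι → ℝ) : 0 ≤ v ⬝ᵥ v := by
  rw [← l2Norm_sq]; positivity

lemma l2Norm_eq_zero {v : ι → ℝ} : l2Norm v = 0 ↔ v = 0 := by
  simp [l2Norm]

lemma abs_dotProduct_le (v w : ι → ℝ) : |v ⬝ᵥ w| ≤ l2Norm v * l2Norm w := by
  have := abs_real_inner_le_norm (WithLp.toLp 2 w) (WithLp.toLp 2 v)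
  simpa [l2Norm, EuclideanSpace.inner_eq_star_dotProduct, mul_comm] using this

lemma l1Norm_eq (v : ι → ℝ) : l1Norm v = ∑ i, |v i| := by
  rw [l1Norm, PiLp.norm_eq_of_nat 1 (by simp)]
  simp

end Norms

/-! ### Splitting a vector into blocks of decreasing magnitude -/

section Blocks

variable {ι : Type*} [DecidableEq ι]

/-- The vector that agrees with `h` on `T` and vanishes elsewhere. -/
def coordRestrict (T : Finset ι) (h : ι → ℝ) : ι → ℝ := fun i => if i ∈ T then h i else 0

lemma coordRestrict_empty (h : ι → ℝ) : coordRestrict ∅ h = 0 := by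
  ext i; simp [coordRestrict]

lemma coordRestrict_eq_add {S T : Finset ι} (hTS : T ⊆ S) (h : ι → ℝ) :
    coordRestrict S h = coordRestrict T h + coordRestrict (S \ T) h := by
  ext i
  by_cases h1 : i ∈ T
  · simp [coordRestrict, h1, hTS h1]
  · simp [coordRestrict, h1]

lemma isSparse_of_support {k : ℕ} {v : ι → ℝ} (T : Finset ι) (hT : T.card ≤ k)
    (hv : ∀ i, i ∉ T → v i = 0) : IsSparse k v := by
  have hsub : {i | v i ≠ 0} ⊆ (T : Set ι) := fun i hi => by
    by_contra h
    exact hi (hv i h)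
  calc {i | v i ≠ 0}.ncard ≤ (T : Set ι).ncard := Set.ncard_le_ncard hsub T.finite_toSet
    _ = T.card := Set.ncard_coe_finset T
    _ ≤ k := hT

lemma dotProduct_coordRestrict [Fintype ι] (T : Finset ι) (h w : ι → ℝ) :
    coordRestrict T h ⬝ᵥ w = ∑ i ∈ T, h i * w i := by
  simp [dotProduct, coordRestrict, Finset.sum_ite_mem, ite_mul]

lemma coordRestrict_dotProduct_self [Fintype ι] (T : Finset ι) (h : ι → ℝ) :
    coordRestrict T h ⬝ᵥ coordRestrict T h = ∑ i ∈ T, h i ^ 2 := by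
  rw [dotProduct_coordRestrict]
  exact Finset.sum_congr rfl fun i hi => by simp [coordRestrict, hi, sq]

lemma coordRestrict_dotProduct_eq_zero [Fintype ι] {S T : Finset ι} (hST : Disjoint S T)
    (h : ι → ℝ) : coordRestrict S h ⬝ᵥ coordRestrict T h = 0 := by
  rw [dotProduct_coordRestrict]
  exact Finset.sum_eq_zero fun i hi => by
    simp [coordRestrict, Finset.disjoint_left.mp hST hi]

lemma exists_subset_of_largest (f : ι → ℝ) (S : Finset ι) (k : ℕ) (hk : k ≤ S.card) :
    ∃ T ⊆ S, T.card = k ∧ ∀ i ∈ T, ∀ j ∈ S \ T, f j ≤ f i := by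
  induction k with
  | zero => exact ⟨∅, by simp, by simp, by simp⟩
  | succ k ih =>
    obtain ⟨T, hTS, hcard, hT⟩ := ih (by omega)
    have hne : (S \ T).Nonempty := by
      rw [← Finset.card_pos, Finset.card_sdiff_of_subset hTS]; omega
    obtain ⟨j, hj, hmax⟩ := Finset.exists_max_image (S \ T) f hne
    have hj' := Finset.mem_sdiff.mp hj
    refine ⟨insert j T, Finset.insert_subset hj'.1 hTS, by
      rw [Finset.card_insert_of_notMem hj'.2, hcard], ?_⟩
    intro i hi l hl
    have hl' : l ∈ S \ T := by
      simp only [Finset.mem_sdiff, Finset.mem_insert, not_or] at hl ⊢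
      exact ⟨hl.1, hl.2.2⟩
    rcases Finset.mem_insert.mp hi with rfl | hi
    · exact hmax l hl'
    · exact hT i hi l hl'

/-- Remove from `S` a block `T` of `k` largest entries of `h`. Then the rest of `h` on `S` behaves,
under a linear functional that is bounded by `M` on blocks of length at most `k`, as if its
Euclidean norm were at most `k^{-1/2}` times the `ℓ₁` norm of `h` on `S`. The rest is cut
into blocks of decreasing magnitude, and the Euclidean norm of each block is at most `k^{-1/2}`
times the `ℓ₁` norm of the block before it. -/
lemma exists_head_block [Fintype ι] {k : ℕ} (hk : 0 < k) (h : ι → ℝ) (S : Finset ι) :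
    ∃ T ⊆ S, T.card ≤ k ∧ ∀ (G : (ι → ℝ) →ₗ[ℝ] ℝ) (M : ℝ), 0 ≤ M →
      (∀ U ⊆ S \ T, U.card ≤ k → |G (coordRestrict U h)| ≤ M * l2Norm (coordRestrict U h)) →
      |G (coordRestrict (S \ T) h)| ≤ M * ((∑ i ∈ S, |h i|) / √k) := by
  induction hn : S.card using Nat.strong_induction_on generalizing S with
  | _ n ih =>
  by_cases hSk : S.card ≤ k
  · refine ⟨S, subset_rfl, hSk, fun G M hM _ => ?_⟩
    simp only [Finset.sdiff_self, coordRestrict_empty, map_zero, abs_zero]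
    positivity
  push Not at hSk
  obtain ⟨T, hTS, hcard, hT⟩ := exists_subset_of_largest (fun i => |h i|) S k hSk.le
  obtain ⟨T', hT'S, hcard', hT'⟩ := ih (S \ T).card (by
    rw [Finset.card_sdiff_of_subset hTS]; omega) (S \ T) rfl
  refine ⟨T, hTS, hcard.le, fun G M hM hG => ?_⟩
  have hkpos : (0 : ℝ) < k := by exact_mod_cast hk
  have h1 := hT' G M hM fun U hU hUk => hG U (hU.trans Finset.sdiff_subset) hUk
  have h2 := hG T' hT'S hcard'
  have h3 : l2Norm (coordRestrict T' h) ≤ (∑ i ∈ T, |h i|) / √k := by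
    have hmean : ∀ j ∈ T', |h j| ≤ (∑ i ∈ T, |h i|) / k := fun j hj => by
      rw [le_div_iff₀ hkpos, mul_comm, ← hcard, ← nsmul_eq_mul]
      exact Finset.card_nsmul_le_sum _ _ _ fun i hi => hT i hi j (hT'S hj)
    have hs : 0 ≤ ∑ i ∈ T, |h i| := Finset.sum_nonneg fun _ _ => abs_nonneg _
    apply (sq_le_sq₀ (l2Norm_nonneg _) (by positivity)).mp
    rw [l2Norm_sq, coordRestrict_dotProduct_self, div_pow, Real.sq_sqrt hkpos.le]
    calc ∑ i ∈ T', h i ^ 2 ≤ ∑ i ∈ T', ((∑ i ∈ T, |h i|) / k) ^ 2 :=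
          Finset.sum_le_sum fun i hi => by
            rw [← sq_abs]; exact pow_le_pow_left₀ (abs_nonneg _) (hmean i hi) 2
      _ = T'.card * ((∑ i ∈ T, |h i|) / k) ^ 2 := by simp
      _ ≤ k * ((∑ i ∈ T, |h i|) / k) ^ 2 := by
          gcongr
      _ = (∑ i ∈ T, |h i|) ^ 2 / k := by field_simp
  rw [coordRestrict_eq_add hT'S, map_add]
  calc |G (coordRestrict T' h) + G (coordRestrict ((S \ T) \ T') h)|
      ≤ M * ((∑ i ∈ T, |h i|) / √k) + M * ((∑ i ∈ S \ T, |h i|) / √k) :=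
        (abs_add_le _ _).trans (add_le_add (h2.trans (by gcongr)) h1)
    _ = M * ((∑ i ∈ S, |h i|) / √k) := by
        rw [← Finset.sum_sdiff hTS]; ring

end Blocks

/-! ### The projection onto the orthogonal complement of the code -/

section Residual

variable {m n : ℕ} (A : Matrix (Fin m) (Fin n) ℝ)

/-- The bilinear form `⟨(1 - A Aᵀ) v, w⟩`. If the columns of `A` are orthonormal, this is
`⟨Q v, Q w⟩` for the orthogonal projection `Q` onto the kernel of `Aᵀ`. -/
def residualForm (v w : Fin m → ℝ) : ℝ := v ⬝ᵥ w - (Aᵀ *ᵥ v) ⬝ᵥ (Aᵀ *ᵥ w)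

/-- The vector `(1 - A Aᵀ) v`. -/
def residualVec (v : Fin m → ℝ) : Fin m → ℝ := v - A *ᵥ (Aᵀ *ᵥ v)

lemma residualForm_comm (v w : Fin m → ℝ) : residualForm A v w = residualForm A w v := by
  simp [residualForm, dotProduct_comm]

lemma residualForm_add_left (u v w : Fin m → ℝ) :
    residualForm A (u + v) w = residualForm A u w + residualForm A v w := by
  simp only [residualForm, mulVec_add, add_dotProduct]; ring

lemma residualForm_add_right (u v w : Fin m → ℝ) :
    residualForm A u (v + w) = residualForm A u v + residualForm A u w := by
  simp only [residualForm, mulVec_add, dotProduct_add]; ring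

lemma residualForm_smul_left (c : ℝ) (v w : Fin m → ℝ) :
    residualForm A (c • v) w = c * residualForm A v w := by
  simp only [residualForm, mulVec_smul, smul_dotProduct, smul_eq_mul]; ring

lemma residualForm_smul_right (c : ℝ) (v w : Fin m → ℝ) :
    residualForm A v (c • w) = c * residualForm A v w := by
  rw [residualForm_comm, residualForm_smul_left, residualForm_comm]

variable {A}

lemma transpose_mulVec_mulVec (hA : Aᵀ * A = 1) (x : Fin n → ℝ) : Aᵀ *ᵥ (A *ᵥ x) = x := by
  rw [mulVec_mulVec, hA, one_mulVec]

lemma transpose_mulVec_residualVec (hA : Aᵀ * A = 1) (v : Fin m → ℝ) : Aᵀ *ᵥ residualVec A v = 0 := by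
  rw [residualVec, mulVec_sub, transpose_mulVec_mulVec hA, sub_self]

lemma residualVec_sub (v w : Fin m → ℝ) : residualVec A (v - w) = residualVec A v - residualVec A w := by
  simp only [residualVec, mulVec_sub]; abel

lemma residualVec_mulVec (hA : Aᵀ * A = 1) (x : Fin n → ℝ) : residualVec A (A *ᵥ x) = 0 := by
  rw [residualVec, transpose_mulVec_mulVec hA, sub_self]

lemma residualVec_of_transpose_mulVec_eq_zero {v : Fin m → ℝ} (hv : Aᵀ *ᵥ v = 0) :
    residualVec A v = v := by
  rw [residualVec, hv, mulVec_zero, sub_zero]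

lemma residualForm_eq (hA : Aᵀ * A = 1) (v w : Fin m → ℝ) :
    residualForm A v w = residualVec A v ⬝ᵥ residualVec A w := by
  have h : (A *ᵥ (Aᵀ *ᵥ v)) ⬝ᵥ residualVec A w = 0 := by
    rw [dotProduct_comm, dotProduct_mulVec, ← mulVec_transpose, transpose_mulVec_residualVec hA,
      zero_dotProduct]
  have h2 : v ⬝ᵥ (A *ᵥ (Aᵀ *ᵥ w)) = (Aᵀ *ᵥ v) ⬝ᵥ (Aᵀ *ᵥ w) := by
    rw [dotProduct_mulVec, ← mulVec_transpose]
  rw [show residualVec A v = v - A *ᵥ (Aᵀ *ᵥ v) from rfl, sub_dotProduct, h, sub_zero, residualVec,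
    dotProduct_sub, h2, residualForm]

lemma residualForm_self_eq (hA : Aᵀ * A = 1) (v : Fin m → ℝ) :
    residualForm A v v = l2Norm (residualVec A v) ^ 2 := by
  rw [residualForm_eq hA, l2Norm_sq]

lemma residualForm_self_nonneg (hA : Aᵀ * A = 1) (v : Fin m → ℝ) : 0 ≤ residualForm A v v := by
  rw [residualForm_self_eq hA]; positivity

lemma residualForm_self_le (v : Fin m → ℝ) : residualForm A v v ≤ v ⬝ᵥ v := by
  have := dotProduct_self_nonneg (Aᵀ *ᵥ v)
  unfold residualForm; linarith

lemma residualForm_sq_le (hA : Aᵀ * A = 1) (v w : Fin m → ℝ) :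
    residualForm A v w ^ 2 ≤ residualForm A v v * residualForm A w w := by
  rw [residualForm_self_eq hA, residualForm_self_eq hA, residualForm_eq hA, ← mul_pow, ← sq_abs]
  exact pow_le_pow_left₀ (abs_nonneg _) (abs_dotProduct_le _ _) 2

lemma dotProduct_transpose_mulVec_le (hA : Aᵀ * A = 1) (v : Fin m → ℝ) :
    (Aᵀ *ᵥ v) ⬝ᵥ (Aᵀ *ᵥ v) ≤ v ⬝ᵥ v := by
  have := residualForm_self_nonneg hA v
  unfold residualForm at this; linarith

variable (A)

/-- On `k`-sparse vectors `v` the form `⟨Q v, Q v⟩` differs from `p ‖v‖²` by at most `τ ‖v‖²`.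
With `p = 1 - n / m` and `τ = δ p`, this says that `p^{-1/2} Q` is a restricted isometry with
constant `δ`. -/
def ResidualIsometry (p τ : ℝ) (k : ℕ) : Prop :=
  ∀ v : Fin m → ℝ, IsSparse k v → |residualForm A v v - p * (v ⬝ᵥ v)| ≤ τ * (v ⬝ᵥ v)

variable {A}

/-- Polarization: the bilinear forms `⟨Q a, Q b⟩` and `p ⟨a, b⟩` are close if `a` and `b` span sparse
vectors only. -/
lemma ResidualIsometry.abs_residualForm_sub_le {p τ : ℝ} {k : ℕ} (hR : ResidualIsometry A p τ k)
    {a b : Fin m → ℝ} (hs : ∀ α β : ℝ, IsSparse k (α • a + β • b)) :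
    |residualForm A a b - p * (a ⬝ᵥ b)| ≤ τ * l2Norm a * l2Norm b := by
  have hexp : ∀ α β : ℝ, residualForm A (α • a + β • b) (α • a + β • b)
      = α ^ 2 * residualForm A a a + β ^ 2 * residualForm A b b
        + 2 * (α * β) * residualForm A a b := fun α β => by
    simp only [residualForm_add_left, residualForm_add_right, residualForm_smul_left,
      residualForm_smul_right, residualForm_comm A b a]
    ring
  have hdot : ∀ α β : ℝ, (α • a + β • b) ⬝ᵥ (α • a + β • b)
      = α ^ 2 * l2Norm a ^ 2 + β ^ 2 * l2Norm b ^ 2 + 2 * (α * β) * (a ⬝ᵥ b) := fun α β => by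
    simp only [add_dotProduct, dotProduct_add, smul_dotProduct, dotProduct_smul,
      dotProduct_comm b a, smul_eq_mul, l2Norm_sq]
    ring
  by_cases ha : l2Norm a = 0
  · rw [l2Norm_eq_zero.mp ha]; simp [residualForm, l2Norm_zero]
  by_cases hb : l2Norm b = 0
  · rw [l2Norm_eq_zero.mp hb]; simp [residualForm, l2Norm_zero]
  have ha' : 0 < l2Norm a := lt_of_le_of_ne (l2Norm_nonneg a) (Ne.symm ha)
  have hb' : 0 < l2Norm b := lt_of_le_of_ne (l2Norm_nonneg b) (Ne.symm hb)
  -- the weights make the two summands of `α • a ± β • b` equally long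
  have h1 := abs_le.mp (hR _ (hs (l2Norm b) (l2Norm a)))
  have h2 := abs_le.mp (hR _ (hs (l2Norm b) (-l2Norm a)))
  rw [hexp, hdot] at h1 h2
  have hpos : 0 < l2Norm a * l2Norm b := by positivity
  rw [abs_le]
  constructor
  · refine le_of_mul_le_mul_left ?_ hpos
    linarith [h1.1, h2.2]
  · refine le_of_mul_le_mul_left ?_ hpos
    linarith [h1.2, h2.1]

/-- A restricted isometry nearly preserves the orthogonality of sparse vectors. -/
lemma ResidualIsometry.abs_residualForm_le {p τ : ℝ} {k : ℕ} (hR : ResidualIsometry A p τ k)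
    {a b : Fin m → ℝ} (hab : a ⬝ᵥ b = 0) (hs : ∀ α β : ℝ, IsSparse k (α • a + β • b)) :
    |residualForm A a b| ≤ τ * l2Norm a * l2Norm b := by
  simpa [hab] using hR.abs_residualForm_sub_le hs

/-- A vector `h` whose `ℓ₁` norm is carried at least by half by `k` entries is controlled by its
projection, if the projection is a restricted isometry with constant `1/3` at sparsity `2 k`. -/
lemma ResidualIsometry.norm_le_of_cone (hA : Aᵀ * A = 1) {p : ℝ} (hp : 0 < p) {k : ℕ} (hk : 0 < k)
    (hR : ResidualIsometry A p (p / 3) (2 * k)) (h : Fin m → ℝ) (T₀ : Finset (Fin m))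
    (hT₀ : T₀.card ≤ k) (hcone : ∑ i ∈ T₀ᶜ, |h i| ≤ ∑ i ∈ T₀, |h i|) :
    p * l2Norm h ^ 2 ≤ 43 * residualForm A h h := by
  obtain ⟨T₁, hT₁, hcard, htail⟩ := exists_head_block hk h T₀ᶜ
  set a := coordRestrict T₀ h with ha
  set b := coordRestrict T₁ h with hb
  set c := coordRestrict (T₀ᶜ \ T₁) h with hc
  have hkpos : (0 : ℝ) < k := by exact_mod_cast hk
  have hd01 : Disjoint T₀ T₁ := by
    rw [Finset.disjoint_right]; exact fun i hi => Finset.mem_compl.mp (hT₁ hi)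
  have hsplit : h = (a + b) + c := by
    ext i
    by_cases h0 : i ∈ T₀
    · have : i ∉ T₁ := Finset.disjoint_left.mp hd01 h0
      simp [ha, hb, hc, coordRestrict, h0, this]
    · by_cases h1 : i ∈ T₁ <;> simp [ha, hb, hc, coordRestrict, h0, h1]
  have hab : a ⬝ᵥ b = 0 := coordRestrict_dotProduct_eq_zero hd01 h
  have hba : b ⬝ᵥ a = 0 := by rw [dotProduct_comm, hab]
  have hdc : Disjoint (T₀ ∪ T₁) (T₀ᶜ \ T₁) := by
    rw [Finset.disjoint_left]
    intro i hi hi'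
    simp only [Finset.mem_union, Finset.mem_sdiff, Finset.mem_compl] at hi hi'
    tauto
  have hac : a ⬝ᵥ c = 0 :=
    coordRestrict_dotProduct_eq_zero (Finset.disjoint_of_subset_left Finset.subset_union_left hdc) h
  have hbc : b ⬝ᵥ c = 0 :=
    coordRestrict_dotProduct_eq_zero
      (Finset.disjoint_of_subset_left Finset.subset_union_right hdc) h
  -- pairs of blocks of length at most `k` combine to `2 k`-sparse vectors
  have hsparse : ∀ U V : Finset (Fin m), U.card ≤ k → V.card ≤ k → ∀ α β : ℝ,
      IsSparse (2 * k) (α • coordRestrict U h + β • coordRestrict V h) := by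
    intro U V hU hV α β
    refine isSparse_of_support (U ∪ V) ((Finset.card_union_le _ _).trans (by omega)) fun i hi => ?_
    simp only [Finset.mem_union, not_or] at hi
    simp [coordRestrict, hi.1, hi.2]
  -- the `ℓ₁` norm off `T₀` is at most `√k ‖a‖`
  have hl1 : (∑ i ∈ T₀ᶜ, |h i|) / √k ≤ l2Norm a := by
    rw [div_le_iff₀ (Real.sqrt_pos.mpr hkpos)]
    refine hcone.trans ?_
    have h0 : 0 ≤ ∑ i ∈ T₀, |h i| := Finset.sum_nonneg fun _ _ => abs_nonneg _
    refine (sq_le_sq₀ h0 (mul_nonneg (l2Norm_nonneg _) (Real.sqrt_nonneg _))).mp ?_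
    rw [mul_pow, Real.sq_sqrt hkpos.le, l2Norm_sq, ha, coordRestrict_dotProduct_self]
    have hcs := sq_sum_le_card_mul_sum_sq (s := T₀) (f := fun i => |h i|)
    simp only [sq_abs] at hcs
    refine hcs.trans ?_
    rw [mul_comm]
    have : 0 ≤ ∑ i ∈ T₀, h i ^ 2 := Finset.sum_nonneg fun _ _ => sq_nonneg _
    gcongr
  have hna := l2Norm_nonneg a
  have hnb := l2Norm_nonneg b
  have hnc := l2Norm_nonneg c
  -- the rest is at most as long as `a`
  have hc_le : l2Norm c ≤ l2Norm a := by
    have := htail (dotProductBilin ℝ ℝ c) (l2Norm c) hnc fun U _ _ => by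
      simpa [dotProductBilin] using abs_dotProduct_le c (coordRestrict U h)
    by_contra hlt
    push Not at hlt
    have hcc : l2Norm c ^ 2 ≤ l2Norm c * ((∑ i ∈ T₀ᶜ, |h i|) / √k) := by
      rw [l2Norm_sq]; exact (le_abs_self _).trans (by simpa [dotProductBilin] using this)
    nlinarith
  have hG : |residualForm A (a + b) c| ≤ p / 3 * (l2Norm a + l2Norm b) * l2Norm a := by
    let G : (Fin m → ℝ) →ₗ[ℝ] ℝ :=
      { toFun := residualForm A (a + b)
        map_add' := residualForm_add_right A _
        map_smul' := fun r v => by simp [residualForm_smul_right] }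
    refine (htail G (p / 3 * (l2Norm a + l2Norm b)) (by positivity) fun U hU hUk => ?_).trans
      (mul_le_mul_of_nonneg_left hl1 (by positivity))
    have hdU : Disjoint (T₀ ∪ T₁) U := Finset.disjoint_of_subset_right hU hdc
    have e1 := hR.abs_residualForm_le
      (coordRestrict_dotProduct_eq_zero
        (Finset.disjoint_of_subset_left Finset.subset_union_left hdU) h) (hsparse T₀ U hT₀ hUk)
    have e2 := hR.abs_residualForm_le
      (coordRestrict_dotProduct_eq_zero
        (Finset.disjoint_of_subset_left Finset.subset_union_right hdU) h) (hsparse T₁ U hcard hUk)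
    change |residualForm A (a + b) (coordRestrict U h)| ≤ _
    rw [residualForm_add_left]
    refine (abs_add_le _ _).trans ((add_le_add e1 e2).trans (le_of_eq ?_))
    rw [← ha, ← hb]; ring
  -- the square of the length of the head `a + b`
  set X := l2Norm a ^ 2 + l2Norm b ^ 2 with hX
  have hX0 : 0 ≤ X := by positivity
  have hu : (a + b) ⬝ᵥ (a + b) = X := by
    simp only [add_dotProduct, dotProduct_add, hab, hba, hX, l2Norm_sq]; ring
  have hh : l2Norm h ^ 2 = X + l2Norm c ^ 2 := by
    rw [l2Norm_sq, hsplit]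
    simp only [add_dotProduct, dotProduct_add, hab, hba, hac, hbc, dotProduct_comm c, hX, l2Norm_sq]
    ring
  have hiso := abs_le.mp (hR (a + b) (by simpa using hsparse T₀ T₁ hT₀ hcard 1 1))
  rw [hu] at hiso
  have hsum : residualForm A (a + b) h
      = residualForm A (a + b) (a + b) + residualForm A (a + b) c := by
    rw [← residualForm_add_right, ← hsplit]
  have hcs := residualForm_sq_le hA (a + b) h
  have hhh := residualForm_self_nonneg hA h
  set q := residualForm A h h
  set g := residualForm A (a + b) h
  have hg : p * X / 4 ≤ g := by
    have h1 := (abs_le.mp hG).1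
    have h2 : p / 3 * (l2Norm a + l2Norm b) * l2Norm a ≤ p / 3 * (5 / 4 * X) := by
      rw [mul_assoc]
      refine mul_le_mul_of_nonneg_left ?_ (by positivity)
      nlinarith [sq_nonneg (l2Norm a - 2 * l2Norm b)]
    linarith [hiso.1]
  have hg2 : (p * X / 4) ^ 2 ≤ 4 / 3 * (p * X) * q := by
    calc (p * X / 4) ^ 2 ≤ g ^ 2 := pow_le_pow_left₀ (by positivity) hg 2
      _ ≤ _ := hcs
      _ ≤ _ := mul_le_mul_of_nonneg_right (by linarith [hiso.2]) hhh
  have hpX : p * X ≤ 64 / 3 * q := by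
    rcases (mul_nonneg hp.le hX0).eq_or_lt with h0 | h0
    · rw [← h0]; positivity
    · refine le_of_mul_le_mul_left ?_ h0
      linarith
  have hcX : l2Norm c ^ 2 ≤ X := by nlinarith
  calc p * l2Norm h ^ 2 ≤ p * (2 * X) := by rw [hh]; gcongr; linarith
    _ ≤ 43 * q := by linarith

end Residual

/-! ### Solutions of the second-order cone program -/

section Decoding

variable {m n : ℕ} {A : Matrix (Fin m) (Fin n) ℝ}

lemma feasible_residualVec (hA : Aᵀ * A = 1) {ε : ℝ} (hε : 0 ≤ ε) {v : Fin m → ℝ}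
    (hv : residualForm A v v ≤ ε ^ 2) : SOCPFeasible A ε (residualVec A v) := by
  refine ⟨(sq_le_sq₀ (l2Norm_nonneg _) hε).mp ?_, transpose_mulVec_residualVec hA v⟩
  rwa [← residualForm_self_eq hA]

lemma continuous_residualForm_self : Continuous fun v : Fin m → ℝ => residualForm A v v := by
  unfold residualForm
  fun_prop

/-- In terms of the misfit `w = y - A x' - z'` the program minimizes `‖w‖₁` over the closed set of
all `w` with `‖Q (y - w)‖ ≤ ε`, and the `ℓ₁` norm is coercive. -/
lemma exists_isSOCPSolution (hA : Aᵀ * A = 1) {ε : ℝ} (hε : 0 ≤ ε) (y : Fin m → ℝ) :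
    ∃ xhat zhat, IsSOCPSolution A y ε xhat zhat := by
  let s : Set (PiLp 1 fun _ : Fin m => ℝ) :=
    {w | residualForm A (y - WithLp.ofLp w) (y - WithLp.ofLp w) ≤ ε ^ 2}
  have hs : IsClosed s := isClosed_le
    (continuous_residualForm_self.comp (continuous_const.sub (PiLp.continuous_ofLp 1 _)))
    continuous_const
  have hne : s.Nonempty := ⟨WithLp.toLp 1 y, by
    simp only [s, Set.mem_ofPred_eq, sub_self, residualForm, mulVec_zero, dotProduct_zero]
    positivity⟩
  have : ProperSpace (PiLp 1 fun _ : Fin m => ℝ) := FiniteDimensional.proper ℝ _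
  obtain ⟨w, hw, hmin⟩ := hs.exists_infDist_eq_dist hne 0
  set w' := WithLp.ofLp w with hw'
  have hmisfit : y - A *ᵥ (Aᵀ *ᵥ (y - w')) - residualVec A (y - w') = w' := by
    simp only [residualVec]; abel
  refine ⟨Aᵀ *ᵥ (y - w'), residualVec A (y - w'), feasible_residualVec hA hε hw, ?_⟩
  intro x' z' hz'
  rw [hmisfit]
  have hmem : WithLp.toLp 1 (y - A *ᵥ x' - z') ∈ s := by
    change residualForm A (y - (y - A *ᵥ x' - z')) (y - (y - A *ᵥ x' - z')) ≤ ε ^ 2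
    have e : residualVec A (y - (y - A *ᵥ x' - z')) = z' := by
      rw [show y - (y - A *ᵥ x' - z') = A *ᵥ x' - (-z') by abel, residualVec_sub,
        residualVec_mulVec hA, residualVec_of_transpose_mulVec_eq_zero]
      · abel
      · rw [mulVec_neg, hz'.2, neg_zero]
    rw [residualForm_self_eq hA, e]
    exact (sq_le_sq₀ (l2Norm_nonneg _) hε).mpr hz'.1
  have h1 := Metric.infDist_le_dist_of_mem (x := (0 : PiLp 1 fun _ : Fin m => ℝ)) hmem
  rw [hmin, dist_zero_left, dist_zero_left] at h1
  exact h1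

/-- A competitor of smaller `ℓ₁` norm than a vector with support in `T` differs from it mostly
on `T`. -/
lemma cone_of_l1Norm_le {e h : Fin m → ℝ} (T : Finset (Fin m)) (he : ∀ i, i ∉ T → e i = 0)
    (hle : l1Norm (e + h) ≤ l1Norm e) : ∑ i ∈ Tᶜ, |h i| ≤ ∑ i ∈ T, |h i| := by
  rw [l1Norm_eq, l1Norm_eq, ← Finset.sum_add_sum_compl T, ← Finset.sum_add_sum_compl T] at hle
  have h1 : ∑ i ∈ Tᶜ, |(e + h) i| = ∑ i ∈ Tᶜ, |h i| := Finset.sum_congr rfl fun i hi => by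
    simp [he i (Finset.mem_compl.mp hi)]
  have h2 : ∑ i ∈ Tᶜ, |e i| = 0 := Finset.sum_eq_zero fun i hi => by
    simp [he i (Finset.mem_compl.mp hi)]
  have h3 : ∑ i ∈ T, |e i| - ∑ i ∈ T, |h i| ≤ ∑ i ∈ T, |(e + h) i| := by
    rw [← Finset.sum_sub_distrib]
    refine Finset.sum_le_sum fun i _ => ?_
    have := abs_sub_abs_le_abs_sub (e i) (-(h i))
    simpa using this
  rw [h1, h2] at hle
  linarith

lemma l2Norm_sub_sq_le {ι : Type*} [Fintype ι] (v w : ι → ℝ) :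
    l2Norm (v - w) ^ 2 ≤ 2 * l2Norm v ^ 2 + 2 * l2Norm w ^ 2 := by
  have h := l2Norm_sub_le v w
  have h0 := l2Norm_nonneg (v - w)
  nlinarith [sq_nonneg (l2Norm v - l2Norm w)]

lemma l2Norm_transpose_mulVec_sq_le (hA : Aᵀ * A = 1) (v : Fin m → ℝ) :
    l2Norm (Aᵀ *ᵥ v) ^ 2 ≤ l2Norm v ^ 2 := by
  rw [l2Norm_sq, l2Norm_sq]; exact dotProduct_transpose_mulVec_le hA v

/-- The error bound for one realization `z` of the small errors whose projection has length at
most `ε`. -/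
lemma IsSOCPSolution.norm_sub_sq_le (hA : Aᵀ * A = 1) {p : ℝ} (hp : 0 < p) {k : ℕ}
    (hR : ResidualIsometry A p (p / 3) (2 * k)) {ε : ℝ} (hε : 0 ≤ ε) {z e : Fin m → ℝ}
    (hz : residualForm A z z ≤ ε ^ 2) (he : IsSparse k e) (x : Fin n → ℝ) {xhat : Fin n → ℝ}
    {zhat : Fin m → ℝ} (hsol : IsSOCPSolution A (A *ᵥ x + (e + z)) ε xhat zhat) :
    l2Norm (xhat - x) ^ 2 ≤ 2 * l2Norm z ^ 2 + 344 * ε ^ 2 / p := by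
  obtain ⟨⟨hzn, hzA⟩, hmin⟩ := hsol
  set h := A *ᵥ x + (e + z) - A *ᵥ xhat - zhat - e with hh
  have hh' : h = A *ᵥ (x - xhat) - (zhat - z) := by
    rw [hh, mulVec_sub]; abel
  -- the true errors are feasible, up to a change of the signal
  have hl1 : l1Norm (e + h) ≤ l1Norm e := by
    have h1 := hmin (x + Aᵀ *ᵥ z) (residualVec A z) (feasible_residualVec hA hε hz)
    have e1 : A *ᵥ x + (e + z) - A *ᵥ (x + Aᵀ *ᵥ z) - residualVec A z = e := by
      simp only [residualVec, mulVec_add]; abel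
    rw [e1] at h1
    rwa [show e + h = A *ᵥ x + (e + z) - A *ᵥ xhat - zhat by rw [hh]; abel]
  have hQ : residualVec A h = residualVec A z - zhat := by
    rw [hh', residualVec_sub, residualVec_mulVec hA, residualVec_sub,
      residualVec_of_transpose_mulVec_eq_zero hzA]
    abel
  have hQh : residualForm A h h ≤ 4 * ε ^ 2 := by
    rw [residualForm_self_eq hA, hQ]
    have h1 := l2Norm_sub_sq_le (residualVec A z) zhat
    rw [← residualForm_self_eq hA] at h1
    have h2 := (sq_le_sq₀ (l2Norm_nonneg _) hε).mpr hzn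
    linarith
  have hx : xhat - x = Aᵀ *ᵥ (z - h) := by
    have e1 : z - h = zhat - A *ᵥ (x - xhat) := by rw [hh']; abel
    rw [e1, mulVec_sub, hzA, transpose_mulVec_mulVec hA]; abel
  classical
  have hT : ∃ T : Finset (Fin m), T.card ≤ k ∧ ∀ i, i ∉ T → e i = 0 := by
    refine ⟨Finset.univ.filter fun i => e i ≠ 0, ?_, fun i hi => by simpa using hi⟩
    rw [← Set.ncard_coe_finset]
    simpa [IsSparse] using he
  obtain ⟨T, hTk, hTe⟩ := hT
  have hcone := cone_of_l1Norm_le T hTe hl1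
  have hhn : p * l2Norm h ^ 2 ≤ 172 * ε ^ 2 := by
    rcases Nat.eq_zero_or_pos k with rfl | hk
    · obtain rfl : T = ∅ := by simpa using hTk
      have h0 : h = 0 := by
        ext i
        have hi : |h i| ≤ 0 := by
          refine le_trans ?_ hcone
          exact Finset.single_le_sum (f := fun i => |h i|) (fun _ _ => abs_nonneg _) (by simp)
        simpa using hi
      rw [h0, l2Norm_zero]
      have := sq_nonneg ε
      simp only [ne_eq, OfNat.ofNat_ne_zero, not_false_eq_true, zero_pow, mul_zero]
      positivity
    · have := hR.norm_le_of_cone hA hp hk h T hTk hcone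
      linarith
  have hhn' : l2Norm h ^ 2 ≤ 172 * ε ^ 2 / p := by
    rw [le_div_iff₀ hp]; linarith
  calc l2Norm (xhat - x) ^ 2 ≤ l2Norm (z - h) ^ 2 := by
        rw [hx]; exact l2Norm_transpose_mulVec_sq_le hA _
    _ ≤ 2 * l2Norm z ^ 2 + 2 * l2Norm h ^ 2 := l2Norm_sub_sq_le z h
    _ ≤ 2 * l2Norm z ^ 2 + 2 * (172 * ε ^ 2 / p) := by gcongr
    _ = _ := by ring

end Decoding

/-! ### Isometry constants -/

section IsometryConstant

lemma IsSparse.mono {ι : Type*} {j k : ℕ} (hjk : j ≤ k) {v : ι → ℝ} (h : IsSparse j v) :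
    IsSparse k v := le_trans h hjk

variable {ι κ : Type*} [Fintype ι] [Fintype κ]

/-- The infimum that defines the isometry constant is attained. -/
lemma isometryConstant_spec (Φ : Matrix ι κ ℝ) (k : ℕ) {B : ℝ} (hB : 0 ≤ B)
    (hΦ : ∀ x, l2Norm (Φ *ᵥ x) ^ 2 ≤ B * l2Norm x ^ 2) :
    0 ≤ isometryConstant Φ k ∧ ∀ x, IsSparse k x →
      (1 - isometryConstant Φ k) * l2Norm x ^ 2 ≤ l2Norm (Φ *ᵥ x) ^ 2 ∧
      l2Norm (Φ *ᵥ x) ^ 2 ≤ (1 + isometryConstant Φ k) * l2Norm x ^ 2 := by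
  set S := {δ : ℝ | 0 ≤ δ ∧ ∀ x : κ → ℝ, IsSparse k x →
    (1 - δ) * l2Norm x ^ 2 ≤ l2Norm (Φ *ᵥ x) ^ 2 ∧
    l2Norm (Φ *ᵥ x) ^ 2 ≤ (1 + δ) * l2Norm x ^ 2} with hS
  have hne : S.Nonempty := by
    refine ⟨1 + B, by positivity, fun x _ => ?_⟩
    have := sq_nonneg (l2Norm x)
    have := sq_nonneg (l2Norm (Φ *ᵥ x))
    have := hΦ x
    constructor <;> nlinarith
  have hbdd : BddBelow S := ⟨0, fun δ hδ => hδ.1⟩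
  have hclosed : IsClosed S := by
    have : S = Set.Ici 0 ∩ ⋂ x : κ → ℝ, ⋂ _ : IsSparse k x,
        {δ : ℝ | (1 - δ) * l2Norm x ^ 2 ≤ l2Norm (Φ *ᵥ x) ^ 2} ∩
        {δ : ℝ | l2Norm (Φ *ᵥ x) ^ 2 ≤ (1 + δ) * l2Norm x ^ 2} := by
      ext δ; simp [hS]
    rw [this]
    refine isClosed_Ici.inter (isClosed_iInter fun x => isClosed_iInter fun _ => ?_)
    exact (isClosed_le (by fun_prop) (by fun_prop)).inter (isClosed_le (by fun_prop) (by fun_prop))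
  exact hclosed.csInf_mem hne hbdd

lemma isometryConstant_mono (Φ : Matrix ι κ ℝ) {j k : ℕ} (hjk : j ≤ k) {B : ℝ} (hB : 0 ≤ B)
    (hΦ : ∀ x, l2Norm (Φ *ᵥ x) ^ 2 ≤ B * l2Norm x ^ 2) :
    isometryConstant Φ j ≤ isometryConstant Φ k := by
  have h := isometryConstant_spec Φ k hB hΦ
  exact csInf_le ⟨0, fun δ hδ => hδ.1⟩ ⟨h.1, fun x hx => h.2 x (hx.mono hjk)⟩

/-- The hypothesis on the isometry constants of `√(m/n) Aᵀ` forces `δ_{2k} ≤ (m/n - 1) / 3`, by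
monotonicity. After rescaling, the projection onto the kernel of `Aᵀ` then has isometry
constant at most `1/3` at sparsity `2k`. -/
lemma residualIsometry_of_isometryConstant {m n : ℕ} (hn : 0 < n) (hm : 0 < m)
    {A : Matrix (Fin m) (Fin n) ℝ} (hA : Aᵀ * A = 1) {k : ℕ}
    (hδ : isometryConstant (√((m : ℝ) / n) • Aᵀ) (3 * k)
      + 1 / 2 * isometryConstant (√((m : ℝ) / n) • Aᵀ) (2 * k) < 1 / 2 * ((m : ℝ) / n - 1)) :
    ResidualIsometry A (((m : ℝ) - n) / m) (((m : ℝ) - n) / m / 3) (2 * k) := by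
  have hn' : (0 : ℝ) < n := by exact_mod_cast hn
  have hm' : (0 : ℝ) < m := by exact_mod_cast hm
  have hnorm : ∀ x, l2Norm ((√((m : ℝ) / n) • Aᵀ) *ᵥ x) ^ 2
      = (m : ℝ) / n * l2Norm (Aᵀ *ᵥ x) ^ 2 := fun x => by
    rw [smul_mulVec, l2Norm_smul, mul_pow, sq_abs, Real.sq_sqrt (by positivity)]
  have hΦ : ∀ x, l2Norm ((√((m : ℝ) / n) • Aᵀ) *ᵥ x) ^ 2 ≤ (m : ℝ) / n * l2Norm x ^ 2 :=
    fun x => by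
      rw [hnorm]
      exact mul_le_mul_of_nonneg_left (l2Norm_transpose_mulVec_sq_le hA x) (by positivity)
  have hB : (0 : ℝ) ≤ (m : ℝ) / n := by positivity
  have hmono := isometryConstant_mono (√((m : ℝ) / n) • Aᵀ) (show 2 * k ≤ 3 * k by omega) hB hΦ
  obtain ⟨-, hspec⟩ := isometryConstant_spec (√((m : ℝ) / n) • Aᵀ) (2 * k) hB hΦ
  set δ := isometryConstant (√((m : ℝ) / n) • Aᵀ) (2 * k)
  have hδ' : δ ≤ ((m : ℝ) / n - 1) / 3 := by linarith
  intro v hv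
  obtain ⟨h1, h2⟩ := hspec v hv
  rw [hnorm] at h1 h2
  have hN := sq_nonneg (l2Norm v)
  have h1' : (1 - ((m : ℝ) / n - 1) / 3) * l2Norm v ^ 2 ≤ (m : ℝ) / n * l2Norm (Aᵀ *ᵥ v) ^ 2 :=
    le_trans (by gcongr) h1
  have h2' : (m : ℝ) / n * l2Norm (Aᵀ *ᵥ v) ^ 2 ≤ (1 + ((m : ℝ) / n - 1) / 3) * l2Norm v ^ 2 :=
    le_trans h2 (by gcongr)
  rw [residualForm, ← l2Norm_sq, ← l2Norm_sq]
  have e : (m : ℝ) / n * ((n : ℝ) / m) = 1 := by field_simp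
  have f1 := mul_le_mul_of_nonneg_left h1' (show (0 : ℝ) ≤ n / m by positivity)
  have f2 := mul_le_mul_of_nonneg_left h2' (show (0 : ℝ) ≤ n / m by positivity)
  have g1 : (n : ℝ) / m * ((1 - ((m : ℝ) / n - 1) / 3) * l2Norm v ^ 2)
      = ((n : ℝ) / m - (1 - (n : ℝ) / m) / 3) * l2Norm v ^ 2 := by field_simp
  have g2 : (n : ℝ) / m * ((1 + ((m : ℝ) / n - 1) / 3) * l2Norm v ^ 2)
      = ((n : ℝ) / m + (1 - (n : ℝ) / m) / 3) * l2Norm v ^ 2 := by field_simp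
  have g3 : (n : ℝ) / m * ((m : ℝ) / n * l2Norm (Aᵀ *ᵥ v) ^ 2) = l2Norm (Aᵀ *ᵥ v) ^ 2 := by
    field_simp
  have g4 : ((m : ℝ) - n) / m = 1 - (n : ℝ) / m := by field_simp
  rw [g1, g3] at f1
  rw [g2, g3] at f2
  rw [g4, abs_le]
  constructor <;> linarith

end IsometryConstant

/-! ### Chi-square tails -/

section ChiSquare

lemma noiseLaw_one (m : ℕ) : noiseLaw m 1 = Measure.pi fun _ => gaussianReal 0 1 := by
  simp [noiseLaw]

instance (m : ℕ) (σ : ℝ) : IsProbabilityMeasure (noiseLaw m σ) := by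
  unfold noiseLaw; infer_instance

lemma noiseLaw_eq_map (m : ℕ) (σ : ℝ) : noiseLaw m σ = (noiseLaw m 1).map fun x => σ • x := by
  have h := Measure.pi_map_pi (μ := fun _ : Fin m => gaussianReal 0 1)
    (f := fun _ => fun x : ℝ => σ * x) (fun _ => by fun_prop)
  rw [noiseLaw_one, noiseLaw]
  change _ = Measure.map (fun (x : Fin m → ℝ) i => σ * x i) _
  rw [h]
  congr 1
  ext1 _
  rw [gaussianReal_map_const_mul]
  congr 1
  · simp
  · ext; simp [sq_nonneg]

lemma gaussianPDFReal_mul_exp_sq (t x : ℝ) :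
    gaussianPDFReal 0 1 x * Real.exp (t * x ^ 2)
      = (√(2 * Real.pi))⁻¹ * Real.exp (-(1 / 2 - t) * x ^ 2) := by
  simp only [gaussianPDFReal, NNReal.coe_one, mul_one, sub_zero, mul_assoc, ← Real.exp_add]
  ring_nf

lemma integrable_exp_mul_sq_gaussianReal {t : ℝ} (ht : t < 1 / 2) :
    Integrable (fun x => Real.exp (t * x ^ 2)) (gaussianReal 0 1) := by
  rw [gaussianReal_of_var_ne_zero _ one_ne_zero,
    integrable_withDensity_iff_integrable_smul' (by fun_prop)
      (Filter.Eventually.of_forall fun _ => gaussianPDF_lt_top)]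
  simp only [toReal_gaussianPDF, smul_eq_mul, gaussianPDFReal_mul_exp_sq]
  exact (integrable_exp_neg_mul_sq (by linarith)).const_mul _

lemma integral_exp_mul_sq_gaussianReal {t : ℝ} (ht : t < 1 / 2) :
    ∫ x, Real.exp (t * x ^ 2) ∂(gaussianReal 0 1) = (√(1 - 2 * t))⁻¹ := by
  rw [integral_gaussianReal_eq_integral_smul one_ne_zero]
  simp only [smul_eq_mul, gaussianPDFReal_mul_exp_sq]
  rw [integral_const_mul, integral_gaussian, ← Real.sqrt_inv, ← Real.sqrt_inv,
    ← Real.sqrt_mul (by positivity)]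
  congr 1
  have : 1 / 2 - t ≠ 0 := by linarith
  have : 1 - 2 * t ≠ 0 := by linarith
  have := Real.pi_ne_zero
  field_simp

variable {m : ℕ}

lemma exp_mul_sum_sq (J : Finset (Fin m)) (t : ℝ) (x : Fin m → ℝ) :
    Real.exp (t * ∑ i ∈ J, x i ^ 2)
      = ∏ i, (if i ∈ J then fun y : ℝ => Real.exp (t * y ^ 2) else fun _ => 1) (x i) := by
  rw [Finset.mul_sum, Real.exp_sum, ← Finset.prod_filter_mul_prod_filter_not Finset.univ (· ∈ J)]
  rw [Finset.prod_eq_one (s := Finset.univ.filter (· ∉ J)), mul_one]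
  · rw [Finset.filter_mem_eq_inter, Finset.univ_inter]
    exact Finset.prod_congr rfl fun i hi => by simp [hi]
  · intro i hi
    simp [(Finset.mem_filter.mp hi).2]

lemma integrable_exp_mul_sum_sq (J : Finset (Fin m)) {t : ℝ} (ht : t < 1 / 2) :
    Integrable (fun x : Fin m → ℝ => Real.exp (t * ∑ i ∈ J, x i ^ 2)) (noiseLaw m 1) := by
  rw [noiseLaw_one]
  simp only [exp_mul_sum_sq]
  refine Integrable.fintype_prod fun i => ?_
  by_cases hi : i ∈ J
  · simpa [hi] using integrable_exp_mul_sq_gaussianReal ht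
  · simp [hi]

lemma mgf_sum_sq (J : Finset (Fin m)) {t : ℝ} (ht : t < 1 / 2) :
    mgf (fun x : Fin m → ℝ => ∑ i ∈ J, x i ^ 2) (noiseLaw m 1) t
      = (√(1 - 2 * t))⁻¹ ^ J.card := by
  rw [noiseLaw_one, mgf]
  simp only [exp_mul_sum_sq]
  rw [integral_fintype_prod_eq_prod]
  have : ∀ i : Fin m, ∫ x, (if i ∈ J then fun y : ℝ => Real.exp (t * y ^ 2) else fun _ => 1) x
      ∂(gaussianReal 0 1) = if i ∈ J then (√(1 - 2 * t))⁻¹ else 1 := fun i => by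
    by_cases hi : i ∈ J
    · simpa [hi] using integral_exp_mul_sq_gaussianReal ht
    · simp [hi]
  simp only [this]
  rw [Finset.prod_ite_mem, Finset.univ_inter, Finset.prod_const]

/-- Upper tail of the chi-square law with `#J` degrees of freedom. For `r = √(1 + 2 t)` the
threshold is `(1 + t) #J`. -/
lemma chiSquare_upper_tail (J : Finset (Fin m)) {r : ℝ} (hr : 1 ≤ r) :
    (noiseLaw m 1).real {x | J.card * ((r ^ 2 + 1) / 2) ≤ ∑ i ∈ J, x i ^ 2}
      ≤ Real.exp (-((r - 1) ^ 2 / 4 * J.card)) := by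
  have hr0 : 0 < r := by linarith
  have hinv : 1 / r ≤ 1 := by rw [div_le_one hr0]; exact hr
  -- `t` minimizes the Chernoff exponent after `-log (1 - 2 t) / 2` is replaced by its upper bound
  -- `t + t ^ 2 / (1 - 2 t)`
  set t := (1 - 1 / r) / 2 with ht
  have ht0 : 0 ≤ t := by linarith
  have ht1 : t < 1 / 2 := by
    have : 0 < 1 / r := by positivity
    linarith
  refine (measure_ge_le_exp_mul_mgf _ ht0 (integrable_exp_mul_sum_sq J ht1)).trans ?_
  rw [mgf_sum_sq J ht1]
  have hlog : Real.log r ≤ (r - 1 / r) / 2 := by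
    have h := Real.self_le_sinh_iff.mpr (Real.log_nonneg hr)
    rwa [Real.sinh_log hr0, ← one_div] at h
  have h1 : (√(1 - 2 * t))⁻¹ ≤ Real.exp ((r - 1 / r) / 4) := by
    rw [show 1 - 2 * t = r⁻¹ by rw [ht]; ring, Real.sqrt_inv, inv_inv, Real.sqrt_le_iff]
    refine ⟨(Real.exp_pos _).le, ?_⟩
    rw [← Real.exp_nat_mul, ← Real.log_le_iff_le_exp hr0]
    push_cast
    linarith
  calc Real.exp (-t * (J.card * ((r ^ 2 + 1) / 2))) * (√(1 - 2 * t))⁻¹ ^ J.card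
      ≤ Real.exp (-t * (J.card * ((r ^ 2 + 1) / 2))) * Real.exp ((r - 1 / r) / 4) ^ J.card := by
        gcongr
    _ = Real.exp (-((r - 1) ^ 2 / 4 * J.card)) := by
        rw [← Real.exp_nat_mul, ← Real.exp_add]
        congr 1
        rw [ht]
        field_simp
        ring

/-- Lower tail of the chi-square law with `#J` degrees of freedom. -/
lemma chiSquare_lower_tail (J : Finset (Fin m)) {b : ℝ} (hb : 0 ≤ b) :
    (noiseLaw m 1).real {x | ∑ i ∈ J, x i ^ 2 ≤ (1 - b) * J.card}
      ≤ Real.exp (-(b ^ 2 / 4 * J.card)) := by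
  have ht1 : -(b / 2) < 1 / 2 := by linarith
  refine (measure_le_le_exp_mul_mgf _ (by linarith) (integrable_exp_mul_sum_sq J ht1)).trans ?_
  rw [mgf_sum_sq J ht1]
  have hlog : b - b ^ 2 / 2 ≤ Real.log (1 + b) := by
    refine le_trans ?_ (Real.le_log_one_add_of_nonneg hb)
    rw [le_div_iff₀ (by positivity)]
    nlinarith [pow_nonneg hb 3]
  have h1 : (√(1 - 2 * -(b / 2)))⁻¹ ≤ Real.exp (-(b / 2 - b ^ 2 / 4)) := by
    rw [show 1 - 2 * -(b / 2) = 1 + b by ring, Real.exp_neg]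
    refine inv_anti₀ (Real.exp_pos _) (Real.le_sqrt_of_sq_le ?_)
    rw [← Real.exp_nat_mul, ← Real.le_log_iff_exp_le (by positivity)]
    push_cast
    linarith
  calc Real.exp (- -(b / 2) * ((1 - b) * J.card)) * (√(1 - 2 * -(b / 2)))⁻¹ ^ J.card
      ≤ Real.exp (- -(b / 2) * ((1 - b) * J.card))
        * Real.exp (-(b / 2 - b ^ 2 / 4)) ^ J.card := by
        gcongr
    _ = Real.exp (-(b ^ 2 / 4 * J.card)) := by
        rw [← Real.exp_nat_mul, ← Real.exp_add]
        congr 1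
        ring

/-- A chi-square variable deviates from its mean by the factor `1/15` with exponentially small
probability. -/
lemma chiSquare_concentration (J : Finset (Fin m)) :
    (noiseLaw m 1).real {x | J.card / 15 < |∑ i ∈ J, x i ^ 2 - J.card|}
      ≤ 2 * Real.exp (-(9 / 10000 * J.card)) := by
  have hJ : (0 : ℝ) ≤ J.card := by positivity
  have hsub : {x : Fin m → ℝ | J.card / 15 < |∑ i ∈ J, x i ^ 2 - J.card|}
      ⊆ {x | J.card * (((53 / 50 : ℝ) ^ 2 + 1) / 2) ≤ ∑ i ∈ J, x i ^ 2}
        ∪ {x | ∑ i ∈ J, x i ^ 2 ≤ (1 - 1 / 15) * J.card} := by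
    intro x hx
    have hx' : (J.card : ℝ) / 15 < |∑ i ∈ J, x i ^ 2 - J.card| := hx
    rcases lt_abs.mp hx' with h | h
    · left
      change (J.card : ℝ) * (((53 / 50 : ℝ) ^ 2 + 1) / 2) ≤ ∑ i ∈ J, x i ^ 2
      linarith
    · right
      change ∑ i ∈ J, x i ^ 2 ≤ (1 - 1 / 15) * (J.card : ℝ)
      linarith
  refine (measureReal_mono hsub).trans ((measureReal_union_le _ _).trans ?_)
  have h1 := chiSquare_upper_tail J (show (1 : ℝ) ≤ 53 / 50 by norm_num)
  have h2 := chiSquare_lower_tail J (show (0 : ℝ) ≤ 1 / 15 by norm_num)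
  have h3 : Real.exp (-((1 / 15 : ℝ) ^ 2 / 4 * J.card)) ≤ Real.exp (-(9 / 10000 * J.card)) :=
    Real.exp_le_exp.mpr (by linarith)
  have h4 : Real.exp (-((53 / 50 - 1 : ℝ) ^ 2 / 4 * J.card))
      ≤ Real.exp (-(9 / 10000 * J.card)) := Real.exp_le_exp.mpr (by linarith)
  linarith

end ChiSquare

/-! ### The projection of a Gaussian vector -/

section GaussianResidual

variable {m n : ℕ} {A : Matrix (Fin m) (Fin n) ℝ}

/-- Extend the columns of `A` to an orthonormal basis of `ℝ^m`. The coordinates of a standard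
Gaussian vector in this basis are again independent standard Gaussians, and the projection
keeps those beyond the columns of `A`. -/
lemma exists_map_residualForm_eq (hA : Aᵀ * A = 1) (hnm : n ≤ m) :
    ∃ J : Finset (Fin m), (J.card : ℝ) = (m : ℝ) - n ∧
      (noiseLaw m 1).map (fun z => residualForm A z z)
        = (noiseLaw m 1).map fun x => ∑ i ∈ J, x i ^ 2 := by
  classical
  let E := EuclideanSpace ℝ (Fin m)
  let s : Set (Fin m) := Set.range (Fin.castLE hnm)
  let v : Fin m → E := fun i => if h : i.val < n then WithLp.toLp 2 (A.col ⟨i, h⟩) else 0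
  have hcol : ∀ j : Fin n, v (Fin.castLE hnm j) = WithLp.toLp 2 (A.col j) := fun j => by
    simp [v]
  have hv : Orthonormal ℝ (s.domRestrict v) := by
    rw [orthonormal_iff_ite]
    rintro ⟨_, i, rfl⟩ ⟨_, j, rfl⟩
    have h := congrFun (congrFun hA j) i
    rw [Matrix.mul_apply] at h
    have hij : (⟨Fin.castLE hnm i, ⟨i, rfl⟩⟩ : s) = ⟨Fin.castLE hnm j, ⟨j, rfl⟩⟩ ↔ j = i :=
      (Subtype.ext_iff.trans (Fin.castLE_injective hnm).eq_iff).trans eq_comm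
    simp only [Set.domRestrict_apply, hcol, hij]
    rw [EuclideanSpace.inner_eq_star_dotProduct]
    simpa [dotProduct, Matrix.one_apply] using h
  obtain ⟨b, hb⟩ := hv.exists_orthonormalBasis_extension_of_card_eq (by simp [E])
  have hbj : ∀ j : Fin n, b (Fin.castLE hnm j) = WithLp.toLp 2 (A.col j) := fun j => by
    rw [hb _ ⟨j, rfl⟩, hcol]
  refine ⟨(Finset.univ.image (Fin.castLE hnm))ᶜ, ?_, ?_⟩
  · rw [Finset.card_compl, Finset.card_image_of_injective _ (Fin.castLE_injective hnm)]
    simp [Nat.cast_sub hnm]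
  let F : E → ℝ := fun u => residualForm A (WithLp.ofLp u) (WithLp.ofLp u)
  have hF : Measurable F :=
    (continuous_residualForm_self.comp (PiLp.continuous_ofLp 2 _)).measurable
  have hpi := (map_pi_eq_stdGaussian (ι := Fin m)).trans (stdGaussian_eq_map_pi_orthonormalBasis b)
  have hmap := congrArg (fun μ => μ.map F) hpi
  simp only at hmap
  rw [Measure.map_map hF (by fun_prop), Measure.map_map hF (by fun_prop), ← noiseLaw_one] at hmap
  refine Eq.trans hmap ?_
  congr 1
  ext x
  set u : E := ∑ i, x i • b i with hu
  have hcoord : ∀ i, inner ℝ (b i) u = x i := fun i => by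
    rw [hu, inner_sum]
    simp [inner_smul_right, b.inner_eq_ite]
  have h1 : WithLp.ofLp u ⬝ᵥ WithLp.ofLp u = ∑ i, x i ^ 2 := by
    have h2 : l2Norm (WithLp.ofLp u) = ‖u‖ := rfl
    rw [← l2Norm_sq, h2, ← b.sum_sq_norm_inner_right u]
    simp [hcoord]
  have h2 : ∀ j, (Aᵀ *ᵥ WithLp.ofLp u) j = x (Fin.castLE hnm j) := fun j => by
    rw [← hcoord, hbj, EuclideanSpace.inner_eq_star_dotProduct]
    simp [mulVec, dotProduct, mul_comm]
  have h3 : (Aᵀ *ᵥ WithLp.ofLp u) ⬝ᵥ (Aᵀ *ᵥ WithLp.ofLp u)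
      = ∑ i ∈ Finset.univ.image (Fin.castLE hnm), x i ^ 2 := by
    rw [Finset.sum_image fun _ _ _ _ h => Fin.castLE_injective hnm h]
    simp [dotProduct, h2, sq]
  change residualForm A (WithLp.ofLp u) (WithLp.ofLp u) = _
  rw [residualForm, h1, h3, ← Finset.sum_add_sum_compl (Finset.univ.image (Fin.castLE hnm))]
  ring

lemma noiseLaw_real_residualForm_eq (hA : Aᵀ * A = 1) (hnm : n ≤ m) :
    ∃ J : Finset (Fin m), (J.card : ℝ) = (m : ℝ) - n ∧ ∀ s : Set ℝ, MeasurableSet s →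
      (noiseLaw m 1).real {z | residualForm A z z ∈ s}
        = (noiseLaw m 1).real {x | ∑ i ∈ J, x i ^ 2 ∈ s} := by
  obtain ⟨J, hJ, hmap⟩ := exists_map_residualForm_eq hA hnm
  refine ⟨J, hJ, fun s hs => ?_⟩
  have h := congrArg (fun μ => μ.real s) hmap
  rwa [map_measureReal_apply continuous_residualForm_self.measurable hs,
    map_measureReal_apply (by fun_prop) hs] at h

end GaussianResidual

/-! ### Decoding with Gaussian noise -/

section GaussianDecoding

variable {m n : ℕ} {A : Matrix (Fin m) (Fin n) ℝ}

/-- The error bound of `IsSOCPSolution.norm_sub_sq_le` applies unless `‖Q z‖` or `‖z‖` is large;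
these are two chi-square events, with `m - n` and `m` degrees of freedom. -/
lemma ResidualIsometry.socpDecodes (hA : Aᵀ * A = 1) (hnm : n < m) {k : ℕ}
    (hR : ResidualIsometry A (((m : ℝ) - n) / m) (((m : ℝ) - n) / m / 3) (2 * k)) {t : ℝ}
    (ht : 0 < t) : SOCPDecodes A k t (10 + 344 * (1 + t)) := by
  intro σ hσ
  have hnm' : (0 : ℝ) < (m : ℝ) - n := by
    have : (n : ℝ) < m := by exact_mod_cast hnm
    linarith
  have hm : (0 : ℝ) < m := by
    have : (0 : ℝ) ≤ n := by positivity
    linarith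
  set ε := √(((m : ℝ) - n) * (1 + t)) * σ with hε
  have hε0 : 0 ≤ ε := by positivity
  have hε2 : ε ^ 2 = σ ^ 2 * (((m : ℝ) - n) * (1 + t)) := by
    rw [hε, mul_pow, Real.sq_sqrt (by positivity)]; ring
  set E : Set (Fin m → ℝ) := {z | residualForm A z z ≤ ε ^ 2} ∩ {z | z ⬝ᵥ z ≤ σ ^ 2 * (5 * m)}
    with hE
  have hmeas : MeasurableSet E :=
    ((isClosed_le continuous_residualForm_self continuous_const).inter
      (isClosed_le (by fun_prop) continuous_const)).measurableSet
  refine ⟨E, hmeas, ?_, ?_⟩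
  · set r := √(1 + 2 * t) with hr
    have hr2 : r ^ 2 = 1 + 2 * t := Real.sq_sqrt (by positivity)
    have hr1 : 1 ≤ r := Real.le_sqrt_of_sq_le (by linarith)
    have hγ : gammaOf t ^ 2 * ((m : ℝ) - n) / 2 = (r - 1) ^ 2 / 4 * ((m : ℝ) - n) := by
      rw [gammaOf, div_pow, Real.sq_sqrt (by norm_num)]; ring
    obtain ⟨J, hJ, hlaw⟩ := noiseLaw_real_residualForm_eq hA hnm.le
    have h1 : (noiseLaw m 1).real {z | ((m : ℝ) - n) * (1 + t) ≤ residualForm A z z}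
        ≤ Real.exp (-((r - 1) ^ 2 / 4 * ((m : ℝ) - n))) := by
      have h2 := chiSquare_upper_tail J hr1
      rw [hJ, hr2, show (1 + 2 * t + 1) / 2 = 1 + t by ring] at h2
      exact (hlaw (Set.Ici (((m : ℝ) - n) * (1 + t))) measurableSet_Ici).trans_le h2
    have h2 : (noiseLaw m 1).real {z | 5 * (m : ℝ) ≤ z ⬝ᵥ z} < Real.exp (-((m : ℝ) / 2)) := by
      have h3 := chiSquare_upper_tail (m := m) Finset.univ (show (1 : ℝ) ≤ 3 by norm_num)
      have e : {x : Fin m → ℝ | ((Finset.univ : Finset (Fin m)).card : ℝ) * ((3 ^ 2 + 1) / 2)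
          ≤ ∑ i, x i ^ 2} = {z | 5 * (m : ℝ) ≤ z ⬝ᵥ z} := by
        ext x
        simp only [Set.mem_ofPred_eq, Finset.card_univ, Fintype.card_fin, dotProduct, sq]
        norm_num [mul_comm]
      rw [e] at h3
      refine h3.trans_lt (Real.exp_lt_exp.mpr ?_)
      simp only [Finset.card_univ, Fintype.card_fin]
      linarith
    have hcompl : (noiseLaw m σ).real Eᶜ
        ≤ (noiseLaw m 1).real ({z | ((m : ℝ) - n) * (1 + t) ≤ residualForm A z z}
          ∪ {z | 5 * (m : ℝ) ≤ z ⬝ᵥ z}) := by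
      rw [noiseLaw_eq_map, map_measureReal_apply (by fun_prop) hmeas.compl]
      refine measureReal_mono ?_
      intro z hz
      by_contra hcon
      simp only [Set.mem_union, not_or] at hcon
      obtain ⟨g1, g2⟩ := hcon
      have g1' : residualForm A z z < ((m : ℝ) - n) * (1 + t) := not_le.mp g1
      have g2' : z ⬝ᵥ z < 5 * (m : ℝ) := not_le.mp g2
      refine hz ⟨?_, ?_⟩
      · change residualForm A (σ • z) (σ • z) ≤ ε ^ 2
        rw [residualForm_smul_left, residualForm_smul_right, hε2, ← mul_assoc, ← sq]
        gcongr
      · change (σ • z) ⬝ᵥ (σ • z) ≤ σ ^ 2 * (5 * m)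
        rw [smul_dotProduct, dotProduct_smul, smul_eq_mul, smul_eq_mul, ← mul_assoc, ← sq]
        gcongr
    have hsum := hcompl.trans (measureReal_union_le _ _)
    rw [probReal_compl_eq_one_sub hmeas] at hsum
    rw [hγ]
    linarith
  · rintro z ⟨hz1, hz2⟩ x e he
    refine ⟨exists_isSOCPSolution hA hε0 _, fun xhat zhat hsol => ?_⟩
    have hp : 0 < ((m : ℝ) - n) / m := by positivity
    refine (hsol.norm_sub_sq_le hA hp hR hε0 hz1 he x).trans ?_
    have hz2' : l2Norm z ^ 2 ≤ σ ^ 2 * (5 * m) := by rw [l2Norm_sq]; exact hz2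
    have e1 : 344 * ε ^ 2 / (((m : ℝ) - n) / m) = 344 * (1 + t) * m * σ ^ 2 := by
      rw [hε2]; field_simp
    rw [e1]
    linarith

end GaussianDecoding

/-! ### A net of integer vectors -/

section Net

/-- The integer vectors with Euclidean norm at most `√L`. -/
def integerBall (m L : ℕ) : Finset (Fin m → ℤ) :=
  (Fintype.piFinset fun _ => Finset.Icc (-(L : ℤ)) L).filter fun z => ∑ i, z i ^ 2 ≤ L

lemma mem_integerBall {m L : ℕ} {z : Fin m → ℤ} : z ∈ integerBall m L ↔ ∑ i, z i ^ 2 ≤ L := by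
  simp only [integerBall, Finset.mem_filter, Fintype.mem_piFinset, Finset.mem_Icc,
    and_iff_right_iff_imp]
  intro h i
  have h1 : z i ^ 2 ≤ ∑ i, z i ^ 2 :=
    Finset.single_le_sum (f := fun i => z i ^ 2) (fun _ _ => sq_nonneg _) (Finset.mem_univ i)
  have h2 : |z i| ≤ z i ^ 2 := by
    rw [← sq_abs, sq]
    rcases eq_or_ne (z i) 0 with h0 | h0
    · simp [h0]
    · exact le_mul_of_one_le_left (abs_nonneg _) (Int.one_le_abs h0)
  exact abs_le.mp (by omega)

lemma sum_pow_natAbs_le {q : ℝ} (hq : 0 < q) (hq2 : q ≤ 1 / 2) (L : ℕ) :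
    ∑ z ∈ Finset.Icc (-(L : ℤ)) L, q ^ z.natAbs ≤ 1 + 4 * q := by
  have hq1 : 0 < 1 - q := by linarith
  have heven : (fun z : ℤ => q ^ z.natAbs).Even := fun z => by simp
  rw [Finset.sum_Icc_of_even_eq_range heven, two_smul]
  simp only [Int.natAbs_natCast, Int.natAbs_zero, pow_zero]
  have hgeom : ∑ i ∈ Finset.range (L + 1), q ^ i ≤ 1 + 2 * q := by
    rw [geom_sum_eq (by linarith), ← neg_div_neg_eq, div_le_iff₀ (by linarith)]
    have := pow_pos hq (L + 1)
    nlinarith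
  linarith

/-- The generating function `∑_z q^{|z₁| + ⋯ + |z_m|}` bounds the number of integer vectors
in a ball. -/
lemma card_integerBall_le (m L : ℕ) {q : ℝ} (hq : 0 < q) (hq2 : q ≤ 1 / 2) :
    ((integerBall m L).card : ℝ) ≤ Real.exp (L * Real.log (1 / q) + 4 * q * m) := by
  have hterm : ∀ z ∈ integerBall m L, (q ^ L : ℝ) ≤ ∏ i, q ^ (z i).natAbs := by
    intro z hz
    rw [Finset.prod_pow_eq_pow_sum]
    refine pow_le_pow_of_le_one hq.le (by linarith) ?_
    have h1 := mem_integerBall.mp hz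
    have h2 : ((∑ i, (z i).natAbs : ℕ) : ℤ) ≤ ∑ i, z i ^ 2 := by
      push_cast
      refine Finset.sum_le_sum fun i _ => ?_
      rw [← sq_abs, sq]
      rcases eq_or_ne (z i) 0 with h0 | h0
      · simp [h0]
      · exact le_mul_of_one_le_left (abs_nonneg _) (Int.one_le_abs h0)
    exact_mod_cast h2.trans h1
  have h1 : (integerBall m L).card * q ^ L ≤ (1 + 4 * q) ^ m := by
    calc (integerBall m L).card * q ^ L = ∑ _z ∈ integerBall m L, q ^ L := by simp
      _ ≤ ∑ z ∈ integerBall m L, ∏ i, q ^ (z i).natAbs := Finset.sum_le_sum hterm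
      _ ≤ ∑ z ∈ Fintype.piFinset fun _ : Fin m => Finset.Icc (-(L : ℤ)) L,
            ∏ i, q ^ (z i).natAbs :=
          Finset.sum_le_sum_of_subset_of_nonneg (Finset.filter_subset _ _)
            fun _ _ _ => Finset.prod_nonneg fun _ _ => by positivity
      _ = ∏ _i : Fin m, ∑ z ∈ Finset.Icc (-(L : ℤ)) L, q ^ z.natAbs :=
          (Finset.prod_univ_sum (fun _ => Finset.Icc (-(L : ℤ)) L) fun _ z => q ^ z.natAbs).symm
      _ ≤ (1 + 4 * q) ^ m := by
          rw [Finset.prod_const, Finset.card_univ, Fintype.card_fin]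
          exact pow_le_pow_left₀ (Finset.sum_nonneg fun _ _ => by positivity)
            (sum_pow_natAbs_le hq hq2 L) m
  have h2 : (1 + 4 * q) ^ m ≤ Real.exp (4 * q * m) := by
    rw [mul_comm (4 * q), Real.exp_nat_mul, add_comm]
    exact pow_le_pow_left₀ (by positivity) (Real.add_one_le_exp _) m
  have h3 : Real.exp (L * Real.log (1 / q)) = (q ^ L)⁻¹ := by
    rw [Real.exp_nat_mul, Real.exp_log (by positivity), one_div, inv_pow]
  rw [Real.exp_add, h3, ← div_eq_inv_mul, le_div_iff₀ (by positivity)]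
  exact h1.trans h2

lemma exists_int_toward_zero (x : ℝ) : ∃ z : ℤ, |x - z| ≤ 1 ∧ |(z : ℝ)| ≤ |x| := by
  rcases le_total 0 x with hx | hx
  · refine ⟨⌊x⌋, ?_, ?_⟩
    · rw [abs_le]; constructor <;> linarith [Int.floor_le x, Int.lt_floor_add_one x]
    · have : (0 : ℝ) ≤ ⌊x⌋ := by exact_mod_cast Int.floor_nonneg.mpr hx
      rw [abs_of_nonneg this, abs_of_nonneg hx]; exact Int.floor_le x
  · refine ⟨⌈x⌉, ?_, ?_⟩
    · rw [abs_le]; constructor <;> linarith [Int.le_ceil x, Int.ceil_lt_add_one x]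
    · have : ((⌈x⌉ : ℤ) : ℝ) ≤ 0 := by exact_mod_cast Int.ceil_nonpos.mpr hx
      rw [abs_of_nonpos this, abs_of_nonpos hx]; linarith [Int.le_ceil x]

variable {m n : ℕ} {A : Matrix (Fin m) (Fin n) ℝ}

/-- One step of the net argument: a sparse vector `v` is rounded coordinatewise toward zero to a
multiple of an integer vector, and the difference is absorbed by the a priori bound `τ`. -/
lemma ResidualIsometry.improve {p τ β : ℝ} {j : ℕ} (hτ : 0 ≤ τ) (hβ : 0 ≤ β)
    (hR : ResidualIsometry A p τ j)
    (hW : ∀ z ∈ integerBall m (16 * j),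
      |residualForm A (fun i => (z i : ℝ)) (fun i => (z i : ℝ))
        - p * ((fun i => (z i : ℝ)) ⬝ᵥ fun i => (z i : ℝ))|
        ≤ β * ((fun i => (z i : ℝ)) ⬝ᵥ fun i => (z i : ℝ))) :
    ResidualIsometry A p (β + τ / 2) j := by
  classical
  intro v hv
  by_cases hv0 : v = 0
  · simp [hv0, residualForm]
  have hN : 0 < l2Norm v :=
    lt_of_le_of_ne (l2Norm_nonneg v) fun h => hv0 (l2Norm_eq_zero.mp h.symm)
  set S : Finset (Fin m) := Finset.univ.filter fun i => v i ≠ 0 with hS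
  have hSj : S.card ≤ j := by
    rw [← Set.ncard_coe_finset]
    simpa [IsSparse, hS] using hv
  have hvS : ∀ i, i ∉ S → v i = 0 := fun i hi => by simpa [hS] using hi
  have hj : 0 < j := by
    rcases Nat.eq_zero_or_pos j with rfl | hj
    · have hS0 : S = ∅ := by simpa using hSj
      exact absurd (funext fun i => hvS i (by simp [hS0])) hv0
    · exact hj
  have hj' : (0 : ℝ) < j := by exact_mod_cast hj
  -- the mesh size; the rounding error of a `j`-sparse vector is at most `√j` times as long
  set s := l2Norm v / (4 * √j) with hs
  have hspos : 0 < s := by positivity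
  have hs2 : s ^ 2 * (16 * j) = v ⬝ᵥ v := by
    rw [hs, div_pow, mul_pow, Real.sq_sqrt hj'.le, l2Norm_sq]; field_simp; norm_num
  choose z hz1 hz2 using fun i => exists_int_toward_zero (v i / s)
  set w : Fin m → ℝ := fun i => (z i : ℝ) with hw
  have hzS : ∀ i, i ∉ S → w i = 0 := fun i hi => by
    have := hz2 i
    rw [hvS i hi] at this
    simpa [hw] using this
  have hwv : s ^ 2 * (w ⬝ᵥ w) ≤ v ⬝ᵥ v := by
    simp only [dotProduct, Finset.mul_sum]
    refine Finset.sum_le_sum fun i _ => ?_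
    have h1 := pow_le_pow_left₀ (abs_nonneg _) (hz2 i) 2
    rw [sq_abs, sq_abs, div_pow, le_div_iff₀ (by positivity)] at h1
    simp only [hw]
    nlinarith
  have hzW : z ∈ integerBall m (16 * j) := by
    rw [mem_integerBall]
    have h1 : w ⬝ᵥ w ≤ 16 * j := by
      rw [← hs2] at hwv
      exact le_of_mul_le_mul_left hwv (by positivity)
    have h2 : ((∑ i, z i ^ 2 : ℤ) : ℝ) ≤ ((16 * j : ℕ) : ℤ) := by
      push_cast
      simpa [dotProduct, hw, sq] using h1
    exact_mod_cast h2
  have hdiff : l2Norm (v - s • w) ≤ l2Norm v / 4 := by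
    refine (sq_le_sq₀ (l2Norm_nonneg _) (by positivity)).mp ?_
    have hterm : ∀ i ∈ S, (v i - s * w i) ^ 2 ≤ s ^ 2 := fun i _ => by
      have h1 := pow_le_pow_left₀ (abs_nonneg _) (hz1 i) 2
      rw [sq_abs] at h1
      have h2 : v i - s * w i = s * (v i / s - z i) := by simp only [hw]; field_simp
      rw [h2, mul_pow]
      nlinarith [sq_nonneg s]
    have hsum : (v - s • w) ⬝ᵥ (v - s • w) = ∑ i ∈ S, (v i - s * w i) ^ 2 := by
      simp only [dotProduct, Pi.sub_apply, Pi.smul_apply, smul_eq_mul, ← sq]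
      refine (Finset.sum_subset (Finset.subset_univ S) fun i _ hi => ?_).symm
      simp [hvS i hi, hzS i hi]
    rw [l2Norm_sq, hsum, div_pow, l2Norm_sq, ← hs2]
    calc ∑ i ∈ S, (v i - s * w i) ^ 2 ≤ S.card * s ^ 2 := by
          rw [← nsmul_eq_mul]; exact Finset.sum_le_card_nsmul _ _ _ hterm
      _ ≤ j * s ^ 2 := by gcongr
      _ = s ^ 2 * (16 * j) / 4 ^ 2 := by ring
  have hsw : l2Norm (s • w) ≤ l2Norm v := by
    refine (sq_le_sq₀ (l2Norm_nonneg _) hN.le).mp ?_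
    rw [l2Norm_smul, mul_pow, sq_abs, l2Norm_sq, l2Norm_sq]; exact hwv
  have hplus : l2Norm (v + s • w) ≤ 2 * l2Norm v := by
    linarith [l2Norm_add_le v (s • w)]
  have hpol := hR.abs_residualForm_sub_le (a := v - s • w) (b := v + s • w) fun α β =>
    isSparse_of_support S hSj fun i hi => by simp [hvS i hi, hzS i hi]
  have hpol' : |residualForm A (v - s • w) (v + s • w) - p * ((v - s • w) ⬝ᵥ (v + s • w))|
      ≤ τ / 2 * (v ⬝ᵥ v) := by
    refine hpol.trans ?_
    rw [← l2Norm_sq, mul_assoc]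
    calc τ * (l2Norm (v - s • w) * l2Norm (v + s • w))
        ≤ τ * (l2Norm v / 4 * (2 * l2Norm v)) := by
          gcongr
          exact l2Norm_nonneg _
      _ = τ / 2 * l2Norm v ^ 2 := by ring
  have hnet := hW z hzW
  have hident : residualForm A v v - p * (v ⬝ᵥ v)
      = (residualForm A (v - s • w) (v + s • w) - p * ((v - s • w) ⬝ᵥ (v + s • w)))
        + s ^ 2 * (residualForm A w w - p * (w ⬝ᵥ w)) := by
    have hc : residualForm A (v - s • w) (v + s • w)
        = residualForm A v v - s ^ 2 * residualForm A w w := by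
      rw [sub_eq_add_neg, ← neg_smul]
      simp only [residualForm_add_left, residualForm_add_right, residualForm_smul_left,
        residualForm_smul_right, residualForm_comm A w v]
      ring
    have hd : (v - s • w) ⬝ᵥ (v + s • w) = v ⬝ᵥ v - s ^ 2 * (w ⬝ᵥ w) := by
      simp only [sub_dotProduct, dotProduct_add, smul_dotProduct, dotProduct_smul,
        dotProduct_comm w v, smul_eq_mul]
      ring
    rw [hc, hd]; ring
  rw [hident]
  calc _ ≤ τ / 2 * (v ⬝ᵥ v) + s ^ 2 * (β * (w ⬝ᵥ w)) := by
        refine (abs_add_le _ _).trans (add_le_add hpol' ?_)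
        rw [abs_mul, abs_of_nonneg (sq_nonneg s)]
        exact mul_le_mul_of_nonneg_left hnet (sq_nonneg s)
    _ ≤ τ / 2 * (v ⬝ᵥ v) + β * (v ⬝ᵥ v) := by
        have := mul_le_mul_of_nonneg_left hwv hβ
        linarith
    _ = (β + τ / 2) * (v ⬝ᵥ v) := by ring

/-- A bound on the net extends to all sparse vectors, at the cost of a factor `2`. -/
lemma residualIsometry_of_integerBall (hA : Aᵀ * A = 1) {p β : ℝ} {j : ℕ} (hp : 0 ≤ p)
    (hp1 : p ≤ 1) (hβ : 0 ≤ β)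
    (hW : ∀ z ∈ integerBall m (16 * j),
      |residualForm A (fun i => (z i : ℝ)) (fun i => (z i : ℝ))
        - p * ((fun i => (z i : ℝ)) ⬝ᵥ fun i => (z i : ℝ))|
        ≤ β * ((fun i => (z i : ℝ)) ⬝ᵥ fun i => (z i : ℝ))) :
    ResidualIsometry A p (2 * β) j := by
  have hiter : ∀ N : ℕ, ResidualIsometry A p (2 * β + (1 / 2) ^ N) j := by
    intro N
    induction N with
    | zero =>
      intro v _
      have h0 := residualForm_self_nonneg hA v
      have h1 := residualForm_self_le (A := A) v
      have h2 := dotProduct_self_nonneg v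
      have h3 : p * (v ⬝ᵥ v) ≤ v ⬝ᵥ v := mul_le_of_le_one_left h2 hp1
      have h4 : 0 ≤ p * (v ⬝ᵥ v) := by positivity
      have h5 : 0 ≤ β * (v ⬝ᵥ v) := by positivity
      rw [abs_le]
      constructor <;> linarith
    | succ N ih =>
      have h := ih.improve (by positivity) hβ hW
      rwa [show β + (2 * β + (1 / 2) ^ N) / 2 = 2 * β + (1 / 2) ^ (N + 1) by ring] at h
  intro v hv
  have hlim : Filter.Tendsto (fun N : ℕ => (2 * β + (1 / 2 : ℝ) ^ N) * (v ⬝ᵥ v)) Filter.atTop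
      (nhds ((2 * β + 0) * (v ⬝ᵥ v))) :=
    ((tendsto_pow_atTop_nhds_zero_of_lt_one (by norm_num) (by norm_num)).const_add _).mul_const _
  rw [add_zero] at hlim
  exact ge_of_tendsto' hlim fun N => hiter N v hv

end Net

/-! ### Uniformly random orthonormal columns -/

section Uniform

variable {m n : ℕ}

/-- The reflection that exchanges two vectors of the same length. -/
lemma exists_orthogonal_mulVec_eq {v w : Fin m → ℝ} (h : v ⬝ᵥ v = w ⬝ᵥ w) :
    ∃ U ∈ Matrix.orthogonalGroup (Fin m) ℝ, U *ᵥ v = w := by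
  by_cases hvw : v = w
  · exact ⟨1, one_mem _, by rw [one_mulVec, hvw]⟩
  set u := v - w with hu
  have hu0 : u ⬝ᵥ u ≠ 0 := by
    rw [← l2Norm_sq]
    exact pow_ne_zero 2 fun h0 => hvw (sub_eq_zero.mp (l2Norm_eq_zero.mp h0))
  have hsq : vecMulVec u u * vecMulVec u u = (u ⬝ᵥ u) • vecMulVec u u := by
    rw [vecMulVec_mul_vecMulVec]
    ext i j
    simp [vecMulVec_apply]
    ring
  refine ⟨1 - (2 / (u ⬝ᵥ u)) • vecMulVec u u, ?_, ?_⟩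
  · rw [Matrix.mem_orthogonalGroup_iff]
    rw [transpose_sub, transpose_one, transpose_smul, transpose_vecMulVec]
    simp only [mul_sub, sub_mul, mul_one, one_mul, smul_mul_assoc, mul_smul_comm, hsq, smul_smul]
    rw [div_mul_cancel₀ _ hu0, two_smul, smul_sub, smul_add]
    abel
  · have h1 : u ⬝ᵥ u = 2 * (u ⬝ᵥ v) := by
      simp only [hu, sub_dotProduct, dotProduct_sub, dotProduct_comm w v]
      linarith
    have h2 : 2 / (u ⬝ᵥ u) * (u ⬝ᵥ v) = 1 := by
      rw [div_mul_eq_mul_div, ← h1, div_self hu0]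
    rw [sub_mulVec, one_mulVec, smul_mulVec, vecMulVec_mulVec]
    ext i
    simp only [Pi.sub_apply, Pi.smul_apply, smul_eq_mul, MulOpposite.smul_eq_mul_unop,
      MulOpposite.unop_op]
    rw [mul_left_comm, h2, hu]
    simp

/-- The matrices for which `⟨Q v, Q v⟩` differs from `p ‖v‖²`, with `p = 1 - n / m`, by more than
`p / 6 * ‖v‖²`. -/
def badMatrices (m n : ℕ) (v : Fin m → ℝ) : Set (Fin m → Fin n → ℝ) :=
  {A | ((m : ℝ) - n) / m / 6 * (v ⬝ᵥ v)
    < |residualForm (Matrix.of A) v v - ((m : ℝ) - n) / m * (v ⬝ᵥ v)|}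

lemma continuous_residualForm_prod :
    Continuous fun x : (Fin m → Fin n → ℝ) × (Fin m → ℝ) =>
      residualForm (Matrix.of x.1) x.2 x.2 := by
  have h : Continuous fun x : (Fin m → Fin n → ℝ) × (Fin m → ℝ) => (Matrix.of x.1)ᵀ *ᵥ x.2 :=
    (Continuous.matrix_transpose (A := fun x : (Fin m → Fin n → ℝ) × (Fin m → ℝ) => Matrix.of x.1)
      continuous_fst).matrix_mulVec continuous_snd
  exact (continuous_snd.dotProduct continuous_snd).sub (h.dotProduct h)

lemma measurableSet_badMatrices_prod :
    MeasurableSet {x : (Fin m → Fin n → ℝ) × (Fin m → ℝ) | x.1 ∈ badMatrices m n x.2} := by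
  have h : Continuous fun x : (Fin m → Fin n → ℝ) × (Fin m → ℝ) => x.2 ⬝ᵥ x.2 :=
    continuous_snd.dotProduct continuous_snd
  exact (isOpen_lt (h.const_mul _)
    (continuous_residualForm_prod.sub (h.const_mul _)).abs).measurableSet

lemma measurableSet_badMatrices (v : Fin m → ℝ) : MeasurableSet (badMatrices m n v) :=
  measurable_prodMk_right measurableSet_badMatrices_prod

lemma badMatrices_smul {c : ℝ} (hc : c ≠ 0) (v : Fin m → ℝ) :
    badMatrices m n (c • v) = badMatrices m n v := by
  ext A
  have hc2 : 0 < c ^ 2 := by positivity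
  rw [badMatrices, badMatrices, Set.mem_ofPred_eq, Set.mem_ofPred_eq,
    residualForm_smul_left, residualForm_smul_right, smul_dotProduct, dotProduct_smul,
    smul_eq_mul, smul_eq_mul, ← mul_assoc c c, ← mul_assoc c c, ← sq,
    show c ^ 2 * residualForm (Matrix.of A) v v - ((m : ℝ) - n) / m * (c ^ 2 * (v ⬝ᵥ v))
      = c ^ 2 * (residualForm (Matrix.of A) v v - ((m : ℝ) - n) / m * (v ⬝ᵥ v)) by ring,
    abs_mul, abs_of_pos hc2, mul_left_comm, mul_lt_mul_iff_right₀ hc2]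

lemma residualForm_orthogonal_mul {U : Matrix (Fin m) (Fin m) ℝ}
    (hU : U ∈ Matrix.orthogonalGroup (Fin m) ℝ) (A : Matrix (Fin m) (Fin n) ℝ) (v : Fin m → ℝ) :
    residualForm (U * A) (U *ᵥ v) (U *ᵥ v) = residualForm A v v := by
  have h : Uᵀ * U = 1 := (mem_orthogonalGroup_iff' _ _).mp hU
  rw [residualForm, residualForm, transpose_mul, ← mulVec_mulVec, transpose_mulVec_mulVec h,
    dotProduct_mulVec, ← mulVec_transpose, transpose_mulVec_mulVec h]

lemma dotProduct_orthogonal_mulVec {U : Matrix (Fin m) (Fin m) ℝ}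
    (hU : U ∈ Matrix.orthogonalGroup (Fin m) ℝ) (v : Fin m → ℝ) :
    (U *ᵥ v) ⬝ᵥ (U *ᵥ v) = v ⬝ᵥ v := by
  have h : Uᵀ * U = 1 := (mem_orthogonalGroup_iff' _ _).mp hU
  rw [dotProduct_mulVec, ← mulVec_transpose, transpose_mulVec_mulVec h]

variable {μ : Measure (Fin m → Fin n → ℝ)}

/-- By invariance, the probability of `badMatrices m n v` does not depend on `v ≠ 0`. -/
lemma IsUniformOrthonormal.measure_badMatrices_eq (hμ : IsUniformOrthonormal μ)
    {v w : Fin m → ℝ} (hv : v ≠ 0) (hw : w ≠ 0) :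
    μ (badMatrices m n v) = μ (badMatrices m n w) := by
  have hv' : l2Norm v ≠ 0 := fun h => hv (l2Norm_eq_zero.mp h)
  have hw' : l2Norm w ≠ 0 := fun h => hw (l2Norm_eq_zero.mp h)
  set c := l2Norm v / l2Norm w with hc
  have hlen : v ⬝ᵥ v = (c • w) ⬝ᵥ (c • w) := by
    rw [← l2Norm_sq, ← l2Norm_sq, l2Norm_smul, mul_pow, sq_abs, hc]
    field_simp
  obtain ⟨U, hU, hUv⟩ := exists_orthogonal_mulVec_eq hlen
  rw [← badMatrices_smul (div_ne_zero hv' hw') w, ← hc, ← hUv]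
  have hmeas : Measurable fun A : Fin m → Fin n → ℝ => Matrix.of.symm (U * Matrix.of A) := by
    have : Continuous fun A : Fin m → Fin n → ℝ => U * Matrix.of A :=
      continuous_const.matrix_mul (B := fun A : Fin m → Fin n → ℝ => Matrix.of A) continuous_id
    exact Continuous.measurable (γ := Fin m → Fin n → ℝ) this
  conv_rhs => rw [← hμ.invariant U hU]
  rw [Measure.map_apply hmeas (measurableSet_badMatrices _)]
  congr 1
  ext A
  rw [Set.mem_preimage, badMatrices, badMatrices, Set.mem_ofPred_eq, Set.mem_ofPred_eq,
    Equiv.apply_symm_apply, residualForm_orthogonal_mul hU, dotProduct_orthogonal_mulVec hU]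

/-- For a fixed matrix with orthonormal columns, a Gaussian vector is badly projected with
exponentially small probability. -/
lemma noiseLaw_real_badMatrices_le {A : Matrix (Fin m) (Fin n) ℝ} (hA : Aᵀ * A = 1) (hnm : n < m) :
    (noiseLaw m 1).real {g | Matrix.of.symm A ∈ badMatrices m n g}
      ≤ 4 * Real.exp (-(9 / 10000 * ((m : ℝ) - n))) := by
  obtain ⟨J, hJ, hlaw⟩ := noiseLaw_real_residualForm_eq hA hnm.le
  have hd : (0 : ℝ) < (m : ℝ) - n := by
    have : (n : ℝ) < m := by exact_mod_cast hnm
    linarith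
  have hn0 : (0 : ℝ) ≤ n := by positivity
  have hm : (0 : ℝ) < m := by linarith
  have h1 : (noiseLaw m 1).real {z | ((m : ℝ) - n) / 15 < |residualForm A z z - ((m : ℝ) - n)|}
      ≤ 2 * Real.exp (-(9 / 10000 * ((m : ℝ) - n))) := by
    have h2 := chiSquare_concentration J
    rw [hJ] at h2
    refine (hlaw {x | ((m : ℝ) - n) / 15 < |x - ((m : ℝ) - n)|} ?_).trans_le h2
    exact (isOpen_lt continuous_const (by fun_prop)).measurableSet
  have h2 : (noiseLaw m 1).real {z | (m : ℝ) / 15 < |z ⬝ᵥ z - (m : ℝ)|}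
      ≤ 2 * Real.exp (-(9 / 10000 * ((m : ℝ) - n))) := by
    have h3 := chiSquare_concentration (m := m) Finset.univ
    simp only [Finset.card_univ, Fintype.card_fin] at h3
    have e : {z : Fin m → ℝ | (m : ℝ) / 15 < |z ⬝ᵥ z - (m : ℝ)|}
        = {x | (m : ℝ) / 15 < |∑ i, x i ^ 2 - (m : ℝ)|} := by
      simp only [dotProduct, sq]
    rw [e]
    refine h3.trans ?_
    gcongr
    linarith
  have hsub : {g : Fin m → ℝ | Matrix.of.symm A ∈ badMatrices m n g}
      ⊆ {z | ((m : ℝ) - n) / 15 < |residualForm A z z - ((m : ℝ) - n)|}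
        ∪ {z | (m : ℝ) / 15 < |z ⬝ᵥ z - (m : ℝ)|} := by
    intro g hg
    by_contra hcon
    simp only [Set.mem_union, not_or] at hcon
    obtain ⟨c1, c2⟩ := hcon
    rw [Set.mem_ofPred_eq, not_lt, abs_le] at c1 c2
    have hg' : ((m : ℝ) - n) / m / 6 * (g ⬝ᵥ g)
      < |residualForm A g g - ((m : ℝ) - n) / m * (g ⬝ᵥ g)| := hg
    have hp : 0 < ((m : ℝ) - n) / m := by positivity
    have hpm : ((m : ℝ) - n) / m * m = (m : ℝ) - n := by field_simp
    set p := ((m : ℝ) - n) / m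
    have d1 : p * (14 / 15 * m) ≤ p * (g ⬝ᵥ g) := by gcongr; linarith [c2.1]
    have d2 : p * (g ⬝ᵥ g) ≤ p * (16 / 15 * m) := by gcongr; linarith [c2.2]
    refine absurd hg' (not_lt.mpr (abs_le.mpr ⟨?_, ?_⟩)) <;> linarith [c1.1, c1.2]
  refine (measureReal_mono hsub).trans ((measureReal_union_le _ _).trans ?_)
  linarith

/-- For a fixed vector, a uniformly random matrix is bad with exponentially small probability: by
invariance the vector may be replaced by an independent Gaussian vector. -/
lemma IsUniformOrthonormal.measure_badMatrices_le (hμ : IsUniformOrthonormal μ) (hnm : n < m)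
    (v : Fin m → ℝ) :
    μ (badMatrices m n v) ≤ ENNReal.ofReal (4 * Real.exp (-(9 / 10000 * ((m : ℝ) - n)))) := by
  have := hμ.prob
  by_cases hv : v = 0
  · have : badMatrices m n v = ∅ := by
      ext A
      simp [badMatrices, hv, residualForm]
    simp [this]
  have hne : ∀ᵐ g ∂(noiseLaw m 1), g ≠ 0 := by
    have : Nonempty (Fin m) := ⟨⟨0, by omega⟩⟩
    have := nullSingletonClass_gaussianReal (μ := 0) one_ne_zero
    rw [noiseLaw_one]
    exact Measure.ae_ne _ 0
  set B := {x : (Fin m → Fin n → ℝ) × (Fin m → ℝ) | x.1 ∈ badMatrices m n x.2} with hB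
  have hBm : MeasurableSet B := measurableSet_badMatrices_prod
  calc μ (badMatrices m n v) = ∫⁻ _g, μ (badMatrices m n v) ∂(noiseLaw m 1) := by simp
    _ = ∫⁻ g, μ ((fun A => (A, g)) ⁻¹' B) ∂(noiseLaw m 1) :=
        lintegral_congr_ae (hne.mono fun g hg => hμ.measure_badMatrices_eq hv hg)
    _ = (μ.prod (noiseLaw m 1)) B := (Measure.prod_apply_symm hBm).symm
    _ = ∫⁻ A, noiseLaw m 1 (Prod.mk A ⁻¹' B) ∂μ := Measure.prod_apply hBm
    _ ≤ ∫⁻ _A, ENNReal.ofReal (4 * Real.exp (-(9 / 10000 * ((m : ℝ) - n)))) ∂μ := by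
        refine lintegral_mono_ae (hμ.orthonormal.mono fun A hA => ?_)
        rw [← ofReal_measureReal]
        exact ENNReal.ofReal_le_ofReal (noiseLaw_real_badMatrices_le hA hnm)
    _ = _ := by simp

/-- The union bound over the net. -/
lemma IsUniformOrthonormal.exists_residualIsometry (hμ : IsUniformOrthonormal μ) (hnm : n < m)
    (k : ℕ) :
    ∃ G : Set (Fin m → Fin n → ℝ), MeasurableSet G ∧
      1 - (integerBall m (16 * (2 * k))).card * (4 * Real.exp (-(9 / 10000 * ((m : ℝ) - n))))
        ≤ μ.real G ∧
      ∀ A ∈ G, (Matrix.of A)ᵀ * Matrix.of A = 1 ∧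
        ResidualIsometry (Matrix.of A) (((m : ℝ) - n) / m) (((m : ℝ) - n) / m / 3) (2 * k) := by
  have := hμ.prob
  set W := integerBall m (16 * (2 * k))
  let cast : (Fin m → ℤ) → Fin m → ℝ := fun z i => (z i : ℝ)
  let O : Set (Fin m → Fin n → ℝ) := {A | (Matrix.of A)ᵀ * Matrix.of A = 1}
  have hO : MeasurableSet O := by
    have h : Continuous fun A : Fin m → Fin n → ℝ => (Matrix.of A)ᵀ * Matrix.of A :=
      (Continuous.matrix_transpose (A := fun A : Fin m → Fin n → ℝ => Matrix.of A)
        continuous_id).matrix_mul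
        (B := fun A : Fin m → Fin n → ℝ => Matrix.of A) continuous_id
    exact (isClosed_eq h continuous_const).measurableSet
  have hB : MeasurableSet (⋃ z ∈ W, badMatrices m n (cast z)) :=
    Finset.measurableSet_biUnion _ fun z _ => measurableSet_badMatrices _
  have hOc : μ.real Oᶜ = 0 := by
    have : μ Oᶜ = 0 := ae_iff.mp hμ.orthonormal
    simp [Measure.real, this]
  have hbad : μ.real (⋃ z ∈ W, badMatrices m n (cast z))
      ≤ W.card * (4 * Real.exp (-(9 / 10000 * ((m : ℝ) - n)))) := by
    refine (measureReal_biUnion_finset_le _ _).trans ?_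
    rw [← nsmul_eq_mul]
    refine Finset.sum_le_card_nsmul _ _ _ fun z _ => ?_
    exact ENNReal.toReal_le_of_le_ofReal (by positivity) (hμ.measure_badMatrices_le hnm _)
  refine ⟨(Oᶜ ∪ ⋃ z ∈ W, badMatrices m n (cast z))ᶜ, (hO.compl.union hB).compl, ?_, ?_⟩
  · rw [probReal_compl_eq_one_sub (hO.compl.union hB)]
    have := measureReal_union_le (μ := μ) Oᶜ (⋃ z ∈ W, badMatrices m n (cast z))
    linarith
  · intro A hA
    simp only [Set.compl_union, compl_compl, Set.mem_inter_iff, Set.mem_compl_iff,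
      Set.mem_iUnion, not_exists] at hA
    obtain ⟨hAO, hAW⟩ := hA
    have hn0 : (0 : ℝ) ≤ n := by positivity
    have hnm' : (n : ℝ) < m := by exact_mod_cast hnm
    have hm : (0 : ℝ) < m := by linarith
    have hd : (0 : ℝ) ≤ (m : ℝ) - n := by linarith
    refine ⟨hAO, ?_⟩
    have h := residualIsometry_of_integerBall (A := Matrix.of A) (p := ((m : ℝ) - n) / m)
      (β := ((m : ℝ) - n) / m / 6) (j := 2 * k) hAO (by positivity)
      (by rw [div_le_one hm]; linarith) (by positivity) fun z hz => not_lt.mp (hAW z hz)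
    rwa [show 2 * (((m : ℝ) - n) / m / 6) = ((m : ℝ) - n) / m / 3 by ring] at h

end Uniform

/-! ### Coding with prescribed and with random matrices -/

/-- The weight of the generating function that counts the net, for the aspect ratio `s = n / m`;
its share of the exponent is `9/40000 (m - n)`, a quarter of the exponent of the tail bound. -/
def netWeight (s : ℝ) : ℝ := 9 / 160000 * (1 - s)

/-- The admissible fraction of gross errors for the aspect ratio `s = n / m`; the sparsity of the
net contributes `32 k log (1 / netWeight s)` to the exponent, at most another quarter. -/
def errorFraction (s : ℝ) : ℝ := 9 / 40000 * (1 - s) / (32 * Real.log (1 / netWeight s))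

lemma log_inv_netWeight_pos {s : ℝ} (hs0 : 0 < s) (hs1 : s < 1) :
    0 < Real.log (1 / netWeight s) := by
  have h0 : 0 < netWeight s := by unfold netWeight; linarith
  refine Real.log_pos ?_
  rw [lt_div_iff₀ h0]
  unfold netWeight; linarith

lemma errorFraction_pos {s : ℝ} (hs0 : 0 < s) (hs1 : s < 1) : 0 < errorFraction s := by
  have := log_inv_netWeight_pos hs0 hs1
  have : 0 < 1 - s := by linarith
  unfold errorFraction; positivity

/-- For `k ≤ errorFraction (n / m) * m` the size of the net is outweighed by the tail bound. -/
lemma card_net_le {m n k : ℕ} (hn : 0 < n) (hnm : n < m)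
    (hk : (k : ℝ) ≤ errorFraction ((n : ℝ) / m) * m) :
    ((integerBall m (16 * (2 * k))).card : ℝ) ≤ Real.exp (9 / 20000 * ((m : ℝ) - n)) := by
  have hn' : (0 : ℝ) < n := by exact_mod_cast hn
  have hnm' : (n : ℝ) < m := by exact_mod_cast hnm
  have hm : (0 : ℝ) < m := by linarith
  have hs0 : 0 < (n : ℝ) / m := by positivity
  have hs1 : (n : ℝ) / m < 1 := by rw [div_lt_one hm]; exact hnm'
  have hlog := log_inv_netWeight_pos hs0 hs1
  have hsm : (1 - (n : ℝ) / m) * m = (m : ℝ) - n := by field_simp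
  have hq0 : 0 < netWeight ((n : ℝ) / m) := by unfold netWeight; linarith
  have hq2 : netWeight ((n : ℝ) / m) ≤ 1 / 2 := by unfold netWeight; linarith
  refine (card_integerBall_le m (16 * (2 * k)) hq0 hq2).trans (Real.exp_le_exp.mpr ?_)
  have h1 : (k : ℝ) * (32 * Real.log (1 / netWeight ((n : ℝ) / m)))
      ≤ 9 / 40000 * ((m : ℝ) - n) := by
    rw [errorFraction, div_mul_eq_mul_div, le_div_iff₀ (by positivity), mul_assoc _ _ (m : ℝ),
      hsm] at hk
    exact hk
  have h2 : 4 * netWeight ((n : ℝ) / m) * m = 9 / 40000 * ((m : ℝ) - n) := by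
    rw [← hsm, netWeight]; ring
  push_cast
  rw [h2]
  linarith

end

theorem corollary1 :
    ∃ (ρ : ℝ → ℝ) (κ K : ℝ), (∀ s : ℝ, 0 < s → s < 1 → 0 < ρ s) ∧ 0 < κ ∧ 0 < K ∧
      ∀ t : ℝ, 0 < t → ∃ C : ℝ, 0 < C ∧
        -- coding matrices that satisfy the restricted isometry hypothesis
        (∀ (m n k : ℕ) (A : Matrix (Fin m) (Fin n) ℝ), Aᵀ * A = 1 →
          isometryConstant (√((m : ℝ) / n) • Aᵀ) (3 * k)
              + 1 / 2 * isometryConstant (√((m : ℝ) / n) • Aᵀ) (2 * k)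
            < 1 / 2 * ((m : ℝ) / n - 1) →
          SOCPDecodes A k t C) ∧
        -- coding matrices with uniformly random orthonormal columns
        (∀ (m n k : ℕ), 0 < n → n < m → (k : ℝ) ≤ ρ ((n : ℝ) / m) * m →
          ∀ μ : Measure (Fin m → Fin n → ℝ), IsUniformOrthonormal μ →
            ∃ G : Set (Fin m → Fin n → ℝ), MeasurableSet G ∧
              1 - K * Real.exp (-(κ * ((m : ℝ) - n))) ≤ μ.real G ∧
              ∀ A ∈ G, SOCPDecodes (Matrix.of A) k t C) := by
  refine ⟨errorFraction, 9 / 20000, 4, fun s => errorFraction_pos, by norm_num, by norm_num,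
    fun t ht => ⟨10 + 344 * (1 + t), by positivity, ?_, ?_⟩⟩
  · intro m n k A hA hδ
    -- the isometry constants are nonnegative, so that the hypothesis implies `1 < m / n`
    have hpos : ∀ j, 0 ≤ isometryConstant (√((m : ℝ) / n) • Aᵀ) j := fun j =>
      Real.sInf_nonneg fun δ hδ => hδ.1
    have hratio : 1 < (m : ℝ) / n := by linarith [hpos (3 * k), hpos (2 * k)]
    have hn : 0 < n := by
      rcases Nat.eq_zero_or_pos n with rfl | hn
      · norm_num at hratio
      · exact hn
    have hnm : n < m := by
      rw [one_lt_div (by exact_mod_cast hn)] at hratio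
      exact_mod_cast hratio
    exact (residualIsometry_of_isometryConstant hn (hn.trans hnm) hA hδ).socpDecodes hA hnm ht
  · intro m n k hn hnm hk μ hμ
    obtain ⟨G, hG, hprob, hiso⟩ := hμ.exists_residualIsometry hnm k
    refine ⟨G, hG, le_trans ?_ hprob, fun A hA =>
      (hiso A hA).2.socpDecodes (hiso A hA).1 hnm ht⟩
    have h1 := mul_le_mul_of_nonneg_right (card_net_le hn hnm hk)
      (show 0 ≤ 4 * Real.exp (-(9 / 10000 * ((m : ℝ) - n))) by positivity)
    have h2 : Real.exp (9 / 20000 * ((m : ℝ) - n)) * (4 * Real.exp (-(9 / 10000 * ((m : ℝ) - n))))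
        = 4 * Real.exp (-(9 / 20000 * ((m : ℝ) - n))) := by
      rw [mul_left_comm, ← Real.exp_add]
      congr 2
      ring
    linarith
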